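/- Let $N\ge 1$, let $K$ be a field of characteristic $0$ (for instance $\mathbb R$, $\mathbb C$ or $\mathbb Q(\alpha)$) and let $\alpha\in K$ be not a rational number $\le 0$ (for instance a real $\alpha>0$, or an indeterminate). Permutations $w\in S_N$ act on compositions $\eta\in\mathbb Z_{\ge0}^N$ by $w(\eta)=(\eta_{w^{-1}(1)},\dots,\eta_{w^{-1}(N)})$ and on polynomials in $z_1,\dots,z_N$ by $w z^{\eta}=z^{w(\eta)}$; $s_{ip}$ is the transposition of $i$ and $p$, and $s_i=s_{i\,i+1}$. For compositions $\nu\neq\eta$ with $|\nu|=|\eta|$ write $\nu<\eta$ if $\sum_{j\le p}\nu_j\le\sum_{j\le p}\eta_j$ for all $p$, and write $\nu\prec\eta$ if $\nu^+<\eta^+$, or $\nu^+=\eta^+$ and $\nu<\eta$, where $\eta^+$ is the decreasing rearrangement of $\eta$. The Cherednik operators are $$\xi_i=\alpha z_i\frac{\partial}{\partial z_i}+\sum_{p<i}\frac{z_i}{z_i-z_p}(1-s_{ip})+\sum_{p>i}\frac{z_p}{z_i-z_p}(1-s_{ip})+1-i ,$$ and the nonsymmetric Jack polynomial $E_\eta$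 is the unique polynomial of the form $z^\eta+\sum_{\nu\prec\eta}c_{\eta\nu}z^\nu$ with $\xi_iE_\eta=\bar\eta_iE_\eta$ for all $i$, where $\bar\eta_i=\alpha\eta_i-\#\{k<i\mid\eta_k\ge\eta_i\}-\#\{k>i\mid\eta_k>\eta_i\}$. Let $I,J\subseteq\{1,\dots,N-1\}$ be disjoint and such that no element of $I$ differs by $1$ from an element of $J$. For $A\subseteq\{1,\dots,N-1\}$ let $W_A=\langle s_k\mid k\in A\rangle$; for $w\in W_{I\cup J}$ let $\det_J(w)=\pm1$ be the parity of the number of factors $s_j$, $j\in J$, in a decomposition of $w$ into generators $s_k$, $k\in I\cup J$; and let $\mathcal O_{I,J}=\sum_{w\in W_{I\cup J}}\det_J(w)\,w$. Let $\eta^*$ be a composition with $\eta^*_i\ge\eta^*_{i+1}$ for $i\in I$ and $\eta^*_j>\eta^*_{j+1}$ for $j\in J$. The Jack polynomial with prescribed symmetry $S^{(I,J)}_{\eta^*}$ is the unique polynomial of the form $z^{\eta^*}+\sum_{\nu\prec\eta^*}\tilde c_\nu z^\nu$ such that $\mathcal O_{I,J}E_\eta$ is a scalar multiple of $S^{(I,J)}_{\eta^*}$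 for every $\eta\in W_{I\cup J}(\eta^*)$. Put $$d_\eta=\prod_{i=1}^{N}\prod_{j=1}^{\eta_i}\bigl(\alpha(a(i,j)+1)+l(i,j)+1\bigr),\qquad d'_\eta=\prod_{i=1}^{N}\prod_{j=1}^{\eta_i}\bigl(\alpha(a(i,j)+1)+l(i,j)\bigr),$$ with $a(i,j)=\eta_i-j$ and $l(i,j)=\#\{k<i\mid j\le\eta_k+1\le\eta_i\}+\#\{k>i\mid j\le\eta_k\le\eta_i\}$. Then the polynomials $E_\eta$ and $S^{(I,J)}_{\eta^*}$ exist and are unique, and there is an expansion $$S^{(I,J)}_{\eta^*}=\sum_{\mu\in W_{I\cup J}(\eta^*)}\hat c_{\eta^*\mu}E_\mu .$$ In any such expansion $\hat c_{\eta^*\eta^*}=1$, and whenever $w\in W_{I\cup J}$ is decomposed as $w=w_Iw_J$ with $w_I\in W_I$, $w_J\in W_J$, then with $\mu=w\eta^*$ and $\mu_I=w_I\eta^*$, $$\hat c_{\eta^*\mu}=\det\nolimits_J(w)\,\frac{d'_{\eta^*}\,d_\mu}{d'_{\mu_I}\,d_{\mu_I}} .$$ -/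

import Mathlib

namespace JackPS

variable {n : ℕ} {K : Type*} [Field K]

/-- The action of permutations on `N`-tuples, `N = n + 1`:
`w(η) = (η_{w⁻¹(1)}, …, η_{w⁻¹(N)})`. -/
def act (w : Equiv.Perm (Fin (n + 1))) (η : Fin (n + 1) → ℕ) : Fin (n + 1) → ℕ :=
  fun i => η (w⁻¹ i)

/-- The simple transposition exchanging the (0-based) positions `j` and `j + 1`. -/
def simple (j : Fin n) : Equiv.Perm (Fin (n + 1)) :=
  Equiv.swap j.castSucc j.succ

/-- The group generated by the simple transpositions with index in `A`. -/
def W (A : Finset (Fin n)) : Subgroup (Equiv.Perm (Fin (n + 1))) :=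
  Subgroup.closure (simple '' (A : Set (Fin n)))

/-- `I` and `J` are disjoint and no member of `I` is a neighbour of a member of `J`. -/
def Separated (I J : Finset (Fin n)) : Prop :=
  Disjoint I J ∧ ∀ i ∈ I, ∀ j ∈ J, (i : ℕ) + 1 ≠ j ∧ (j : ℕ) + 1 ≠ i

/-- The composition is weakly decreasing along `I` and strictly decreasing along `J`. -/
def IsLabel (I J : Finset (Fin n)) (η : Fin (n + 1) → ℕ) : Prop :=
  (∀ i ∈ I, η i.succ ≤ η i.castSucc) ∧ (∀ j ∈ J, η j.succ < η j.castSucc)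

open Classical in
/-- `det_J(w)` for `w` in the group generated by the `s_k`, `k ∈ I ∪ J`: the parity of the
number of factors `s_j`, `j ∈ J`, in a decomposition of `w` into such generators. -/
noncomputable def detJ (I J : Finset (Fin n)) (w : Equiv.Perm (Fin (n + 1))) : ℤ :=
  if ∃ l : List (Fin n), (∀ k ∈ l, k ∈ I ∪ J) ∧ (l.map simple).prod = w ∧
      Even (l.countP (fun k => decide (k ∈ J))) then 1 else -1

open Classical in
/-- The orbit of `η` under the group generated by the `s_k`, `k ∈ A`. -/
noncomputable def orbit (A : Finset (Fin n)) (η : Fin (n + 1) → ℕ) :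
    Finset (Fin (n + 1) → ℕ) :=
  (Finset.univ.filter (fun w : Equiv.Perm (Fin (n + 1)) => w ∈ W A)).image (fun w => act w η)

/-- The partition `η⁺`: the decreasing rearrangement of `η`. -/
def plus (η : Fin (n + 1) → ℕ) : Fin (n + 1) → ℕ :=
  fun i => η (Tuple.sort η i.rev)

/-- The strict dominance order on compositions of the same modulus. -/
def DomLt (ν η : Fin (n + 1) → ℕ) : Prop :=
  ν ≠ η ∧ ∑ j, ν j = ∑ j, η j ∧
    ∀ p, ∑ j ∈ Finset.Iic p, ν j ≤ ∑ j ∈ Finset.Iic p, η j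

/-- The order `ν ≺ η`. -/
def Prec (ν η : Fin (n + 1) → ℕ) : Prop :=
  DomLt (plus ν) (plus η) ∨ (plus ν = plus η ∧ DomLt ν η)

/-- `f = z^η + ∑_{ν ≺ η} c_ν z^ν`. -/
def IsMonicTriangular (η : Fin (n + 1) → ℕ) (f : MvPolynomial (Fin (n + 1)) K) : Prop :=
  f.coeff (Finsupp.equivFunOnFinite.symm η) = 1 ∧
    ∀ m ∈ f.support, (m : Fin (n + 1) → ℕ) ≠ η → Prec (m : Fin (n + 1) → ℕ) η

theorem sub_dvd_sub_swap (i p : Fin (n + 1)) (f : MvPolynomial (Fin (n + 1)) K) :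
    (MvPolynomial.X i - MvPolynomial.X p) ∣ f - MvPolynomial.rename (Equiv.swap i p) f := by
  rw [← Ideal.mem_span_singleton, ← Ideal.Quotient.eq]
  set Q : Ideal (MvPolynomial (Fin (n + 1)) K) :=
    Ideal.span {MvPolynomial.X i - MvPolynomial.X p}
  have hip : Ideal.Quotient.mk Q (MvPolynomial.X i) = Ideal.Quotient.mk Q (MvPolynomial.X p) :=
    Ideal.Quotient.eq.2 (Ideal.mem_span_singleton_self _)
  have h : Ideal.Quotient.mkₐ K Q
      = (Ideal.Quotient.mkₐ K Q).comp (MvPolynomial.rename (Equiv.swap i p)) := by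
    ext k
    simp only [AlgHom.comp_apply, MvPolynomial.rename_X, Ideal.Quotient.mkₐ_eq_mk]
    by_cases hi : k = i
    · subst hi
      simpa using hip
    · by_cases hp : k = p
      · subst hp
        simpa using hip.symm
      · rw [Equiv.swap_apply_of_ne_of_ne hi hp]
  exact DFunLike.congr_fun h f

/-- The polynomial `(f - s_{ip} f) / (z_i - z_p)`. -/
noncomputable def divDiff (i p : Fin (n + 1)) (f : MvPolynomial (Fin (n + 1)) K) :
    MvPolynomial (Fin (n + 1)) K :=
  (sub_dvd_sub_swap i p f).choose

theorem mul_divDiff (i p : Fin (n + 1)) (f : MvPolynomial (Fin (n + 1)) K) :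
    (MvPolynomial.X i - MvPolynomial.X p) * divDiff i p f
      = f - MvPolynomial.rename (Equiv.swap i p) f :=
  (sub_dvd_sub_swap i p f).choose_spec.symm

/-- The type `A` Cherednik operator `ξ_i`. The index `i` is 0-based here, so the constant
term `1 - i` of the 1-based formula reads `-i`. -/
noncomputable def cherednik (α : K) (i : Fin (n + 1)) (f : MvPolynomial (Fin (n + 1)) K) :
    MvPolynomial (Fin (n + 1)) K :=
  MvPolynomial.C α * MvPolynomial.X i * MvPolynomial.pderiv i f
    + ∑ p ∈ Finset.Iio i, MvPolynomial.X i * divDiff i p f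
    + ∑ p ∈ Finset.Ioi i, MvPolynomial.X p * divDiff i p f
    - MvPolynomial.C ((i : ℕ) : K) * f

/-- The eigenvalue
`η̄_i = α η_i - #{k < i | η_k ≥ η_i} - #{k > i | η_k > η_i}`. -/
def eig (α : K) (η : Fin (n + 1) → ℕ) (i : Fin (n + 1)) : K :=
  α * (η i : K) - (((Finset.Iio i).filter (fun k => η i ≤ η k)).card : K)
    - (((Finset.Ioi i).filter (fun k => η i < η k)).card : K)

/-- The characterization of the nonsymmetric Jack polynomial `E_η(z; α)`. -/
def IsNonsymJack (α : K) (η : Fin (n + 1) → ℕ) (E : MvPolynomial (Fin (n + 1)) K) : Prop :=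
  (∀ i, cherednik α i E = MvPolynomial.C (eig α η i) * E) ∧ IsMonicTriangular η E

/-- The nonsymmetric Jack polynomial `E_η(z; α)`. -/
noncomputable def nonsymJack (α : K) (η : Fin (n + 1) → ℕ) : MvPolynomial (Fin (n + 1)) K :=
  Classical.epsilon (IsNonsymJack α η)

open Classical in
/-- The operator `O_{I,J} = ∑_{w ∈ W_{I ∪ J}} det_J(w) w` on polynomials; `w z^λ = z^{w(λ)}`. -/
noncomputable def symOp (I J : Finset (Fin n)) (f : MvPolynomial (Fin (n + 1)) K) :
    MvPolynomial (Fin (n + 1)) K :=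
  ∑ w ∈ Finset.univ.filter (fun w : Equiv.Perm (Fin (n + 1)) => w ∈ W (I ∪ J)),
    MvPolynomial.C (detJ I J w : K) * MvPolynomial.rename w f

/-- The characterization of the Jack polynomial with prescribed symmetry `S_{η*}^{(I,J)}`:
it is of the form `z^{η*} + ∑_{ν ≺ η*} c_ν z^ν`, and `O_{I,J} E_η` is a scalar multiple of it
for each `η` in the orbit of `η*` under `W_{I ∪ J}`. -/
def IsPrescribedJack (α : K) (I J : Finset (Fin n)) (ηs : Fin (n + 1) → ℕ)
    (S : MvPolynomial (Fin (n + 1)) K) : Prop :=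
  IsMonicTriangular ηs S ∧
    ∀ η ∈ orbit (I ∪ J) ηs, ∃ a : K, symOp I J (nonsymJack α η) = MvPolynomial.C a * S

/-- The Jack polynomial with prescribed symmetry `S_{η*}^{(I,J)}`. -/
noncomputable def prescribedJack (α : K) (I J : Finset (Fin n)) (ηs : Fin (n + 1) → ℕ) :
    MvPolynomial (Fin (n + 1)) K :=
  Classical.epsilon (IsPrescribedJack α I J ηs)

/-- The arm length of the box `(i, j)`, `1 ≤ j ≤ η_i`. -/
def arm (η : Fin (n + 1) → ℕ) (i : Fin (n + 1)) (j : ℕ) : ℕ := η i - j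

/-- The leg length of the box `(i, j)`, `1 ≤ j ≤ η_i`. -/
def leg (η : Fin (n + 1) → ℕ) (i : Fin (n + 1)) (j : ℕ) : ℕ :=
  ((Finset.Iio i).filter (fun k => j ≤ η k + 1 ∧ η k + 1 ≤ η i)).card
    + ((Finset.Ioi i).filter (fun k => j ≤ η k ∧ η k ≤ η i)).card

/-- `d_η = ∏_{(i,j) ∈ η} (α (a(i,j) + 1) + l(i,j) + 1)`. -/
def dd (α : K) (η : Fin (n + 1) → ℕ) : K :=
  ∏ i, ∏ j ∈ Finset.Icc 1 (η i), (α * ((arm η i j : K) + 1) + (leg η i j : K) + 1)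

/-- `d'_η = ∏_{(i,j) ∈ η} (α (a(i,j) + 1) + l(i,j))`. -/
def dd' (α : K) (η : Fin (n + 1) → ℕ) : K :=
  ∏ i, ∏ j ∈ Finset.Icc 1 (η i), (α * ((arm η i j : K) + 1) + (leg η i j : K))

end JackPS

namespace JackPS

open MvPolynomial

/-! ### Cherednik operators: Hecke relations, intertwiners and the raising operator. -/

section Operators

variable {n : ℕ} {K : Type*} [Field K]

/-! The Cherednik operators and the simple transpositions satisfy the relations of a degenerate
affine Hecke algebra. Hence `s_k - 1/δ`, with `δ` the difference of the eigenvalues at positions `k`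
and `k + 1`, carries a joint eigenfunction to one with those eigenvalues exchanged
(`cherednik_intertwine`). Together with a raising operator this yields a nonzero joint eigenfunction
for every composition (`exists_eigen`). The operators are triangular on monomials (`cherednik_mon`)
and their joint spectrum is simple (`eig_injective`), so this eigenfunction, once normalised, is the
unique `E_η`.

The intertwiners also express `s_k E_μ` through `E_μ` and `E_{s_k μ}` (`rename_simple_nonsymJack`).
The span of the `E_μ` over an orbit of `W_{I∪J}` is therefore stable, and for a sum of `c_μ E_μ` the
condition `s_k S = ±S` (minus for `k ∈ J`) becomes the recursion `c_{s_k μ} = (±1 - 1/δ) c_μ` when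
`μ_k > μ_{k+1}`. A product over inversions solves it (`symCoeff`). Since the recursion connects the
whole orbit, a solution is determined by its value at `η*` (`eq_C_mul_symJack`). So every `O_{I,J}
E_η` is a multiple of the resulting polynomial `symJack`. Conversely `O_{I,J}` multiplies `symJack`
by the order of `W_{I∪J}`, which is nonzero in characteristic 0; this forces uniqueness of `S`.

For the closed formula, `δ` equals `α(a + 1) + l + 1` at the box in row `k`, column `μ_{k+1} + 1`,
the only box whose leg changes under `s_k`. Thus `s_k` multiplies `d_μ` by `(δ + 1)/δ` and `d'_μ` by
`δ/(δ - 1)`. The recursion factor `1 - 1/δ` for `I` is the inverse ratio of the `d'`, and `-1 - 1/δ`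
for `J` is minus the ratio of the `d`. Linear independence of the `E_μ` transfers the result to any
expansion. -/

theorem X_sub_X_ne_zero {i p : Fin (n + 1)} (h : i ≠ p) :
    (X i - X p : MvPolynomial (Fin (n + 1)) K) ≠ 0 :=
  sub_ne_zero.2 ((X_injective (R := K)).ne h)

/-- The quotient was obtained by choice, but cancellation in an integral domain makes it the only
solution of its defining equation. Rules for divided differences can thus be checked after
multiplication by `z_i - z_p`. For `i = p` the choice is arbitrary. -/
theorem divDiff_eq_of_mul_eq {i p : Fin (n + 1)} (h : i ≠ p)
    {f g : MvPolynomial (Fin (n + 1)) K}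
    (hg : (X i - X p) * g = f - rename (Equiv.swap i p) f) : divDiff i p f = g :=
  mul_left_cancel₀ (X_sub_X_ne_zero h) ((mul_divDiff i p f).trans hg.symm)

theorem divDiff_add {i p : Fin (n + 1)} (h : i ≠ p) (f g : MvPolynomial (Fin (n + 1)) K) :
    divDiff i p (f + g) = divDiff i p f + divDiff i p g :=
  divDiff_eq_of_mul_eq h (by rw [mul_add, mul_divDiff, mul_divDiff, map_add]; ring)

theorem divDiff_C_mul {i p : Fin (n + 1)} (h : i ≠ p) (a : K)
    (f : MvPolynomial (Fin (n + 1)) K) :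
    divDiff i p (C a * f) = C a * divDiff i p f :=
  divDiff_eq_of_mul_eq h (by
    rw [mul_left_comm, mul_divDiff, map_mul, rename_C]; ring)

theorem rename_rename_swap (w : Equiv.Perm (Fin (n + 1))) (i p : Fin (n + 1))
    (f : MvPolynomial (Fin (n + 1)) K) :
    rename w (rename (Equiv.swap i p) f) = rename (Equiv.swap (w i) (w p)) (rename w f) := by
  rw [rename_rename, rename_rename]
  congr 2
  funext x
  simp only [Function.comp_apply]
  rw [← Equiv.Perm.mul_apply, ← Equiv.Perm.mul_apply, Equiv.mul_swap_eq_swap_mul]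

theorem rename_divDiff (w : Equiv.Perm (Fin (n + 1))) {i p : Fin (n + 1)} (h : i ≠ p)
    (f : MvPolynomial (Fin (n + 1)) K) :
    rename w (divDiff i p f) = divDiff (w i) (w p) (rename w f) := by
  symm
  refine divDiff_eq_of_mul_eq (w.injective.ne h) ?_
  have := congrArg (rename w) (mul_divDiff i p f)
  rw [map_mul, map_sub, map_sub, rename_X, rename_X, rename_rename_swap] at this
  exact this

theorem divDiff_X_mul_left {i p : Fin (n + 1)} (h : i ≠ p)
    (f : MvPolynomial (Fin (n + 1)) K) :
    divDiff i p (X i * f) = X i * divDiff i p f + rename (Equiv.swap i p) f :=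
  divDiff_eq_of_mul_eq h (by
    rw [mul_add, mul_left_comm, mul_divDiff, map_mul, rename_X, Equiv.swap_apply_left]; ring)

theorem divDiff_X_mul_right {i p : Fin (n + 1)} (h : i ≠ p)
    (f : MvPolynomial (Fin (n + 1)) K) :
    divDiff i p (X p * f) = X p * divDiff i p f - rename (Equiv.swap i p) f :=
  divDiff_eq_of_mul_eq h (by
    rw [mul_sub, mul_left_comm, mul_divDiff, map_mul, rename_X, Equiv.swap_apply_right]; ring)

theorem divDiff_X_mul_of_ne {i p j : Fin (n + 1)} (h : i ≠ p) (hi : j ≠ i) (hp : j ≠ p)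
    (f : MvPolynomial (Fin (n + 1)) K) :
    divDiff i p (X j * f) = X j * divDiff i p f :=
  divDiff_eq_of_mul_eq h (by
    rw [mul_left_comm, mul_divDiff, map_mul, rename_X, Equiv.swap_apply_of_ne_of_ne hi hp]; ring)

/-- The part of the Cherednik operator that is equivariant under all permutations. -/
noncomputable def dunkl (α : K) (i : Fin (n + 1)) (f : MvPolynomial (Fin (n + 1)) K) :
    MvPolynomial (Fin (n + 1)) K :=
  C α * X i * pderiv i f + ∑ p ∈ Finset.univ.erase i, X i * divDiff i p f

theorem dunkl_add (α : K) (i : Fin (n + 1)) (f g : MvPolynomial (Fin (n + 1)) K) :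
    dunkl α i (f + g) = dunkl α i f + dunkl α i g := by
  simp only [dunkl, map_add]
  rw [Finset.sum_congr rfl fun p hp => by
    rw [divDiff_add (Finset.ne_of_mem_erase hp).symm, mul_add], Finset.sum_add_distrib]
  ring

theorem dunkl_C_mul (α : K) (i : Fin (n + 1)) (a : K) (f : MvPolynomial (Fin (n + 1)) K) :
    dunkl α i (C a * f) = C a * dunkl α i f := by
  simp only [dunkl, pderiv_C_mul, mul_add, Finset.mul_sum]
  congr 1
  · ring
  · refine Finset.sum_congr rfl fun p hp => ?_
    rw [divDiff_C_mul (Finset.ne_of_mem_erase hp).symm]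
    ring

theorem dunkl_X_mul_self (α : K) (i : Fin (n + 1)) (f : MvPolynomial (Fin (n + 1)) K) :
    dunkl α i (X i * f) = X i * (dunkl α i f + C α * f
      + ∑ p ∈ Finset.univ.erase i, rename (Equiv.swap i p) f) := by
  simp only [dunkl, pderiv_mul, pderiv_X_self]
  rw [Finset.sum_congr rfl fun p hp => by
    rw [divDiff_X_mul_left (Finset.ne_of_mem_erase hp).symm, mul_add], Finset.sum_add_distrib]
  rw [← Finset.mul_sum, ← Finset.mul_sum, ← Finset.mul_sum]
  ring

theorem dunkl_X_mul_of_ne (α : K) {i j : Fin (n + 1)} (h : j ≠ i)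
    (f : MvPolynomial (Fin (n + 1)) K) :
    dunkl α i (X j * f) = X j * dunkl α i f - X i * rename (Equiv.swap i j) f := by
  have hj : j ∈ Finset.univ.erase i := Finset.mem_erase.2 ⟨h, Finset.mem_univ _⟩
  simp only [dunkl, pderiv_mul, pderiv_X_of_ne h]
  rw [← Finset.add_sum_erase _ _ hj, ← Finset.add_sum_erase _ _ hj, divDiff_X_mul_right h.symm,
    Finset.sum_congr rfl (g := fun p => X j * (X i * divDiff i p f)) fun p hp => by
      rw [divDiff_X_mul_of_ne (Finset.ne_of_mem_erase (Finset.mem_of_mem_erase hp)).symm h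
        (Finset.ne_of_mem_erase hp).symm, mul_left_comm], ← Finset.mul_sum]
  ring

theorem rename_dunkl (α : K) (w : Equiv.Perm (Fin (n + 1))) (i : Fin (n + 1))
    (f : MvPolynomial (Fin (n + 1)) K) :
    rename w (dunkl α i f) = dunkl α (w i) (rename w f) := by
  simp only [dunkl, map_add, map_mul, rename_C, rename_X, map_sum, pderiv_rename w.injective]
  congr 1
  refine Finset.sum_bij (fun p _ => w p) ?_ ?_ ?_ ?_
  · intro p hp
    simpa using hp
  · intro p _ q _ h
    exact w.injective h
  · intro p hp
    exact ⟨w.symm p, by simpa [Equiv.symm_apply_eq] using hp, by simp⟩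
  · intro p hp
    rw [rename_divDiff w (Finset.ne_of_mem_erase hp).symm]

/-- For `p > i`, replacing `z_p` by `z_i` in the numerator costs `s_{ip} - 1`. The `n - i` constants
`-1` combine with `-i` into `-n`, so the sum over `p > i` is the only part that is not equivariant
under permutations. -/
theorem cherednik_eq_dunkl (α : K) (i : Fin (n + 1)) (f : MvPolynomial (Fin (n + 1)) K) :
    cherednik α i f = dunkl α i f + ∑ p ∈ Finset.Ioi i, rename (Equiv.swap i p) f
      - C (n : K) * f := by
  have hu : Finset.univ.erase i = Finset.Iio i ∪ Finset.Ioi i := by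
    ext p
    simp [lt_or_lt_iff_ne]
  have hd : Disjoint (Finset.Iio i) (Finset.Ioi i) :=
    Finset.disjoint_left.2 fun p h1 h2 =>
      lt_asymm (Finset.mem_Iio.1 h1) (Finset.mem_Ioi.1 h2)
  have h1 : ∀ p ∈ Finset.Ioi i, X p * divDiff i p f
      = X i * divDiff i p f + rename (Equiv.swap i p) f - f := fun p _ => by
    linear_combination - mul_divDiff i p f
  have hn : (n : K) = ((i : ℕ) : K) + ((n - (i : ℕ) : ℕ) : K) := by
    rw [← Nat.cast_add, Nat.add_sub_cancel' (Nat.lt_succ_iff.1 i.2)]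
  rw [cherednik, dunkl, hu, Finset.sum_union hd, Finset.sum_congr rfl h1,
    Finset.sum_sub_distrib, Finset.sum_add_distrib, Finset.sum_const, Fin.card_Ioi, hn, C_add,
    nsmul_eq_mul, ← map_natCast (C (σ := Fin (n + 1)) (R := K))]
  have : n + 1 - 1 - (i : ℕ) = n - i := by simp
  rw [this]
  ring

theorem cherednik_add (α : K) (i : Fin (n + 1)) (f g : MvPolynomial (Fin (n + 1)) K) :
    cherednik α i (f + g) = cherednik α i f + cherednik α i g := by
  simp only [cherednik_eq_dunkl, dunkl_add, map_add, Finset.sum_add_distrib]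
  ring

theorem cherednik_C_mul (α : K) (i : Fin (n + 1)) (a : K) (f : MvPolynomial (Fin (n + 1)) K) :
    cherednik α i (C a * f) = C a * cherednik α i f := by
  simp only [cherednik_eq_dunkl, dunkl_C_mul, map_mul, rename_C, ← Finset.mul_sum]
  ring

theorem cherednik_sub (α : K) (i : Fin (n + 1)) (f g : MvPolynomial (Fin (n + 1)) K) :
    cherednik α i (f - g) = cherednik α i f - cherednik α i g := by
  have := cherednik_add α i f (C (-1) * g)
  rw [cherednik_C_mul] at this
  simpa [sub_eq_add_neg] using this

/-- The Cherednik operator as a linear map. -/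
noncomputable def cherednikₗ (α : K) (i : Fin (n + 1)) :
    MvPolynomial (Fin (n + 1)) K →ₗ[K] MvPolynomial (Fin (n + 1)) K where
  toFun := cherednik α i
  map_add' := cherednik_add α i
  map_smul' a f := by simp [smul_eq_C_mul, cherednik_C_mul]

theorem rename_simple_rename_simple (k : Fin n) (f : MvPolynomial (Fin (n + 1)) K) :
    rename (simple k) (rename (simple k) f) = f := by
  rw [rename_rename, simple]
  convert rename_id_apply f
  funext x
  simp

theorem simple_castSucc (k : Fin n) : simple k k.castSucc = k.succ := Equiv.swap_apply_left _ _

theorem simple_succ (k : Fin n) : simple k k.succ = k.castSucc := Equiv.swap_apply_right _ _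

theorem simple_of_ne {k : Fin n} {j : Fin (n + 1)} (h1 : j ≠ k.castSucc) (h2 : j ≠ k.succ) :
    simple k j = j := Equiv.swap_apply_of_ne_of_ne h1 h2

theorem simple_simple (k : Fin n) (j : Fin (n + 1)) : simple k (simple k j) = j := by
  simp [simple]

theorem simple_inv (k : Fin n) : (simple k)⁻¹ = simple k := Equiv.swap_inv _ _

theorem simple_mem_Ioi_iff {k : Fin n} {j p : Fin (n + 1)} (h1 : j ≠ k.castSucc)
    (h2 : j ≠ k.succ) : j < simple k p ↔ j < p := by
  by_cases hp : p = k.castSucc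
  · subst hp
    rw [simple_castSucc]
    simp only [ne_eq, Fin.ext_iff, Fin.lt_def, Fin.val_castSucc, Fin.val_succ] at *
    omega
  by_cases hp' : p = k.succ
  · subst hp'
    rw [simple_succ]
    simp only [ne_eq, Fin.ext_iff, Fin.lt_def, Fin.val_castSucc, Fin.val_succ] at *
    omega
  rw [simple_of_ne hp hp']

theorem rename_simple_cherednik_of_ne (α : K) {k : Fin n} {j : Fin (n + 1)}
    (h1 : j ≠ k.castSucc) (h2 : j ≠ k.succ) (f : MvPolynomial (Fin (n + 1)) K) :
    rename (simple k) (cherednik α j f) = cherednik α j (rename (simple k) f) := by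
  simp only [cherednik_eq_dunkl, map_sub, map_add, map_mul, rename_C, rename_dunkl, map_sum,
    rename_rename_swap, simple_of_ne h1 h2]
  congr 2
  refine Finset.sum_bij (fun p _ => simple k p) ?_ ?_ ?_ ?_
  · intro p hp
    simpa [simple_mem_Ioi_iff h1 h2] using hp
  · intro p _ q _ h
    exact (simple k).injective h
  · intro p hp
    exact ⟨simple k p, by simpa [simple_mem_Ioi_iff h1 h2] using hp, simple_simple k p⟩
  · intro p hp
    rfl

/-- The positions after `k` are those after `k + 1` and `k + 1` itself; this extra exchange term is
`s_k s_k f = f`. -/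
theorem rename_simple_cherednik_castSucc (α : K) (k : Fin n)
    (f : MvPolynomial (Fin (n + 1)) K) :
    rename (simple k) (cherednik α k.castSucc f)
      = cherednik α k.succ (rename (simple k) f) + f := by
  have hk : Finset.Ioi k.castSucc = insert k.succ (Finset.Ioi k.succ) := by
    ext p
    simp only [Finset.mem_Ioi, Finset.mem_insert, Fin.lt_def, Fin.ext_iff, Fin.val_castSucc,
      Fin.val_succ]
    omega
  simp only [cherednik_eq_dunkl, map_sub, map_add, map_mul, rename_C, rename_dunkl, map_sum,
    rename_rename_swap, simple_castSucc]
  rw [hk, Finset.sum_insert (by simp), simple_succ, Equiv.swap_comm]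
  have h0 : rename (Equiv.swap k.castSucc k.succ) (rename (simple k) f) = f :=
    rename_simple_rename_simple k f
  rw [h0]
  have : ∀ p ∈ Finset.Ioi k.succ, rename (Equiv.swap k.succ (simple k p)) (rename (simple k) f)
      = rename (Equiv.swap k.succ p) (rename (simple k) f) := fun p hp => by
    have hp := Finset.mem_Ioi.1 hp
    rw [simple_of_ne (fun h => ?_) hp.ne']
    subst h
    simp [Fin.lt_def] at hp
  rw [Finset.sum_congr rfl this]
  ring

theorem cherednik_castSucc_rename_simple (α : K) (k : Fin n)
    (f : MvPolynomial (Fin (n + 1)) K) :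
    cherednik α k.castSucc (rename (simple k) f)
      = rename (simple k) (cherednik α k.succ f) + f := by
  have := congrArg (rename (simple k))
    (rename_simple_cherednik_castSucc α k (rename (simple k) f))
  rwa [rename_simple_rename_simple, rename_simple_rename_simple, map_add,
    rename_simple_rename_simple] at this

/-- If `f` is a joint eigenfunction then so is `s_k f - δ⁻¹ f`, with permuted eigenvalues. -/
theorem cherednik_intertwine (α : K) (k : Fin n) (f : MvPolynomial (Fin (n + 1)) K)
    (e : Fin (n + 1) → K) (hf : ∀ i, cherednik α i f = C (e i) * f)
    (hδ : e k.castSucc - e k.succ ≠ 0) (i : Fin (n + 1)) :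
    cherednik α i (rename (simple k) f - C (e k.castSucc - e k.succ)⁻¹ * f)
      = C (e (simple k i)) * (rename (simple k) f - C (e k.castSucc - e k.succ)⁻¹ * f) := by
  set δ := e k.castSucc - e k.succ with hδ'
  have hC : (C δ⁻¹ : MvPolynomial (Fin (n + 1)) K) * (C (e k.castSucc) - C (e k.succ)) = 1 := by
    rw [← C_sub, ← C_mul, inv_mul_cancel₀ hδ, C_1]
  rw [cherednik_sub, cherednik_C_mul, hf]
  by_cases h1 : i = k.castSucc
  · subst h1
    rw [cherednik_castSucc_rename_simple, hf, simple_castSucc, map_mul, rename_C]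
    linear_combination - f * hC
  by_cases h2 : i = k.succ
  · subst h2
    have := rename_simple_cherednik_castSucc α k f
    rw [hf, map_mul, rename_C] at this
    rw [simple_succ]
    linear_combination - this + f * hC
  · rw [simple_of_ne h1 h2, ← rename_simple_cherednik_of_ne α h1 h2, hf, map_mul, rename_C]
    ring

/-- The raising operator `f ↦ z_N f(z_N, z_1, …, z_{N-1})`. -/
noncomputable def raise (f : MvPolynomial (Fin (n + 1)) K) : MvPolynomial (Fin (n + 1)) K :=
  X (Fin.last n) * rename (finRotate (n + 1)).symm f

theorem raise_ne_zero {f : MvPolynomial (Fin (n + 1)) K} (hf : f ≠ 0) : raise f ≠ 0 := by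
  refine mul_ne_zero (X_ne_zero _) fun h => hf ?_
  exact (rename_injective _ (finRotate (n + 1)).symm.injective) (h.trans (map_zero _).symm)

/-- No exchange terms belong to the last position, but commuting with the factor `z_N` creates one
for each other position. These are precisely the rotated exchange terms of the first Cherednik
operator. -/
theorem cherednik_last_raise (α : K) (f : MvPolynomial (Fin (n + 1)) K) :
    cherednik α (Fin.last n) (raise f) = raise (cherednik α 0 f + C α * f) := by
  have h0 : (finRotate (n + 1)).symm 0 = Fin.last n := by
    rw [Equiv.symm_apply_eq, finRotate_last]
  have hI : Finset.Ioi (Fin.last n) = ∅ := by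
    ext p
    simp [Fin.le_last]
  simp only [raise, cherednik_eq_dunkl, dunkl_X_mul_self, hI, Finset.sum_empty, map_add, map_sub,
    map_mul, rename_C, rename_dunkl, h0, map_sum, rename_rename_swap]
  have : ∑ p ∈ Finset.Ioi (0 : Fin (n + 1)), rename (Equiv.swap (Fin.last n)
        ((finRotate (n + 1)).symm p)) (rename (finRotate (n + 1)).symm f)
      = ∑ p ∈ Finset.univ.erase (Fin.last n),
        rename (Equiv.swap (Fin.last n) p) (rename (finRotate (n + 1)).symm f) := by
    refine Finset.sum_bij (fun p _ => (finRotate (n + 1)).symm p) ?_ ?_ ?_ ?_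
    · intro p hp
      have hp := (Finset.mem_Ioi.1 hp).ne'
      refine Finset.mem_erase.2 ⟨fun h => hp ?_, Finset.mem_univ _⟩
      rwa [Equiv.symm_apply_eq, finRotate_last] at h
    · intro p _ q _ h
      exact (finRotate (n + 1)).symm.injective h
    · intro p hp
      refine ⟨finRotate (n + 1) p, ?_, by simp⟩
      have hp := Finset.ne_of_mem_erase hp
      rw [Finset.mem_Ioi, Fin.pos_iff_ne_zero, Ne, ← finRotate_last]
      exact fun h => hp ((finRotate (n + 1)).injective h)
    · intro p hp
      rfl
  rw [this]
  ring

/-- The exchange term with the last position turns the factor `z_N` into `z_j` and cancels the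
commutator term of `dunkl_X_mul_of_ne`; the others are the rotated terms at position `j + 1`. -/
theorem cherednik_castSucc_raise (α : K) (j : Fin n) (f : MvPolynomial (Fin (n + 1)) K) :
    cherednik α j.castSucc (raise f) = raise (cherednik α j.succ f) := by
  have hs : ∀ j : Fin n, (finRotate (n + 1)).symm j.succ = j.castSucc := fun j => by
    rw [Equiv.symm_apply_eq, finRotate_apply, Fin.coeSucc_eq_succ]
  have hI : Finset.Ioi j.castSucc
      = insert (Fin.last n) ((Finset.Ioi j).map Fin.castSuccEmb) := by
    ext p
    induction p using Fin.lastCases with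
    | last => simp [Fin.castSucc_lt_last]
    | cast p => simp [Fin.le_last]
  have hI' : Finset.Ioi j.succ = (Finset.Ioi j).map (Fin.succEmb n) := by
    simp
  have hne : ∀ p : Fin n, (Fin.castSucc p) ≠ Fin.last n := Fin.castSucc_ne_last
  simp only [raise, cherednik_eq_dunkl, dunkl_X_mul_of_ne α (hne j).symm, map_add, map_sub,
    map_mul, rename_C, rename_X, rename_dunkl, hs, map_sum, rename_rename_swap]
  rw [hI, hI', Finset.sum_insert (by simp), Finset.sum_map, Finset.sum_map]
  simp only [Fin.castSuccEmb_apply, Fin.coe_succEmb, hs, Equiv.swap_apply_right]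
  rw [Finset.sum_congr rfl (g := fun p => X (Fin.last n)
      * rename (Equiv.swap j.castSucc p.castSucc) (rename (finRotate (n + 1)).symm f))
    fun p hp => by
      rw [Equiv.swap_apply_of_ne_of_ne (hne j).symm (hne p).symm], ← Finset.mul_sum]
  ring

theorem cherednik_one (α : K) (i : Fin (n + 1)) :
    cherednik α i (1 : MvPolynomial (Fin (n + 1)) K) = C (-((i : ℕ) : K)) := by
  have h : ∀ p, p ≠ i → divDiff i p (1 : MvPolynomial (Fin (n + 1)) K) = 0 := fun p hp =>
    divDiff_eq_of_mul_eq hp.symm (by simp)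
  rw [cherednik, Finset.sum_eq_zero fun p hp => by rw [h p (Finset.mem_Iio.1 hp).ne, mul_zero],
    Finset.sum_eq_zero fun p hp => by rw [h p (Finset.mem_Ioi.1 hp).ne', mul_zero]]
  simp

end Operators

/-! ### Eigenvalues, simplicity of the spectrum, and arm and leg combinatorics. -/

section Ranks

variable {n : ℕ} {K : Type*} [Field K]

/-- The number of entries preceding position `i` when `η` is sorted stably in decreasing order. -/
def rk (η : Fin (n + 1) → ℕ) (i : Fin (n + 1)) : ℕ :=
  (Finset.univ.filter (fun k => η i < η k ∨ (η k = η i ∧ k < i))).card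

theorem eig_eq_rk (α : K) (η : Fin (n + 1) → ℕ) (i : Fin (n + 1)) :
    eig α η i = α * (η i : K) - (rk η i : K) := by
  have h : Finset.univ.filter (fun k => η i < η k ∨ (η k = η i ∧ k < i))
      = (Finset.Iio i).filter (fun k => η i ≤ η k)
        ∪ (Finset.Ioi i).filter (fun k => η i < η k) := by
    ext k
    simp only [Finset.mem_filter, Finset.mem_univ, true_and, Finset.mem_union, Finset.mem_Iio,
      Finset.mem_Ioi]
    rcases lt_trichotomy k i with h | h | h
    · simp only [h, h.not_gt, and_true, true_and, false_and, or_false]; omega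
    · subst h; simp
    · simp only [h, h.not_gt, and_false, true_and, false_and, false_or, or_false]
  rw [eig, rk, h, Finset.card_union_of_disjoint]
  · push_cast; ring
  · refine Finset.disjoint_left.2 fun p h1 h2 => ?_
    simp only [Finset.mem_filter, Finset.mem_Iio, Finset.mem_Ioi] at h1 h2
    exact lt_asymm h1.1 h2.1

theorem rk_lt_rk {η : Fin (n + 1) → ℕ} {i j : Fin (n + 1)}
    (h : η j < η i ∨ (η i = η j ∧ i < j)) : rk η i < rk η j := by
  refine Finset.card_lt_card ⟨fun p => ?_, fun hs => ?_⟩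
  · simp only [Finset.mem_filter, Finset.mem_univ, true_and, Fin.lt_def] at *
    omega
  · have := hs (x := i) (by simpa using h)
    simp at this

theorem rk_injective (η : Fin (n + 1) → ℕ) : Function.Injective (rk η) := by
  intro i j h
  by_contra hne
  have : η j < η i ∨ (η i = η j ∧ i < j) ∨ (η i < η j ∨ (η j = η i ∧ j < i)) := by
    rcases lt_or_gt_of_ne hne with h | h <;> omega
  rcases this with h1 | h1 | h1
  · exact (rk_lt_rk (Or.inl h1)).ne h
  · exact (rk_lt_rk (Or.inr h1)).ne h
  · exact (rk_lt_rk h1).ne' h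

theorem rk_lt (η : Fin (n + 1) → ℕ) (i : Fin (n + 1)) : rk η i < n + 1 := by
  have : rk η i < (Finset.univ : Finset (Fin (n + 1))).card := by
    refine Finset.card_lt_card ⟨fun p _ => Finset.mem_univ _, fun hs => ?_⟩
    have := hs (Finset.mem_univ i)
    simp at this
  simpa using this

theorem antivary_rk (η : Fin (n + 1) → ℕ) : Antivary η (rk η) := by
  intro i j h
  by_contra! hlt
  exact lt_asymm h (rk_lt_rk (Or.inl hlt))

/-- The ranking as a permutation. -/
noncomputable def rkPerm (η : Fin (n + 1) → ℕ) : Equiv.Perm (Fin (n + 1)) :=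
  Equiv.ofBijective (fun i => ⟨rk η i, rk_lt η i⟩)
    (Finite.injective_iff_bijective.1 fun _ _ h => rk_injective η (Fin.mk.inj_iff.1 h))

theorem rkPerm_val (η : Fin (n + 1) → ℕ) (i : Fin (n + 1)) : (rkPerm η i : ℕ) = rk η i := rfl

/-- Rearrangement inequality: larger entries receive smaller ranks, so this pairing is the smallest
possible. -/
theorem sum_mul_rk_le (η : Fin (n + 1) → ℕ) (σ : Equiv.Perm (Fin (n + 1))) :
    ∑ i, η i * rk η i ≤ ∑ i, η i * (σ i : ℕ) := by
  have := (antivary_rk η).sum_mul_le_sum_mul_comp_perm (σ := σ.trans (rkPerm η).symm)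
  refine this.trans_eq (Finset.sum_congr rfl fun i _ => ?_)
  rw [← rkPerm_val η, Equiv.trans_apply, Equiv.apply_symm_apply]

/-- The equation reads `α (ν_i - η_i) = rk ν i - rk η (ρ i)`. As `α` is not a rational `≤ 0`, both
differences have the same sign, and the rank difference is nonzero when `ν_i ≠ η_i`. The sum of
their products is thus nonnegative, whereas rearrangement makes it nonpositive, so every product
vanishes. The permutation `ρ` is needed for exchanging the eigenvalues of two equal adjacent
entries. -/
theorem eq_of_eig_eq_comp [CharZero K] {α : K}
    (hα : ∀ a b : ℕ, 0 < a → (a : K) * α + (b : K) ≠ 0) {η ν : Fin (n + 1) → ℕ}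
    (ρ : Equiv.Perm (Fin (n + 1))) (hρ : ∀ i, η (ρ i) = η i)
    (h : ∀ i, eig α ν i = eig α η (ρ i)) : ν = η := by
  have h' : ∀ i, α * ((ν i : K) - η i) = (rk ν i : K) - rk η (ρ i) := fun i => by
    have := h i
    rw [eig_eq_rk, eig_eq_rk, hρ] at this
    linear_combination this
  have hgt : ∀ i, η i < ν i → rk η (ρ i) < rk ν i := by
    intro i hi
    by_contra! hr
    have h := h' i
    refine hα (ν i - η i) (rk η (ρ i) - rk ν i) (by omega) ?_
    rw [Nat.cast_sub hi.le, Nat.cast_sub hr]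
    linear_combination h
  have hlt : ∀ i, ν i < η i → rk ν i < rk η (ρ i) := by
    intro i hi
    by_contra! hr
    have h := h' i
    refine hα (η i - ν i) (rk ν i - rk η (ρ i)) (by omega) ?_
    rw [Nat.cast_sub hi.le, Nat.cast_sub hr]
    linear_combination - h
  have hpos : ∀ i, 0 ≤ ((ν i : ℤ) - η i) * ((rk ν i : ℤ) - rk η (ρ i)) := by
    intro i
    rcases lt_trichotomy (ν i) (η i) with hi | hi | hi
    · have := hlt i hi
      exact mul_nonneg_of_nonpos_of_nonpos (by omega) (by omega)
    · simp [hi]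
    · have := hgt i hi
      exact mul_nonneg (by omega) (by omega)
  -- Two uses of rearrangement: `rk η` is optimal for `η` and `rk ν` for `ν`; `ρ` drops out of the
  -- first because it preserves `η`.
  have hsum : ∑ i, ((ν i : ℤ) - η i) * ((rk ν i : ℤ) - rk η (ρ i)) ≤ 0 := by
    have h0 : ∑ i, (η i : ℤ) * rk η (ρ i) = ∑ i, (η i : ℤ) * rk η i := by
      conv_rhs => rw [← Equiv.sum_comp ρ]
      simp only [hρ]
    have h1 : (∑ i, (η i : ℤ) * rk η i) ≤ ∑ i, (η i : ℤ) * rk ν i := by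
      exact_mod_cast sum_mul_rk_le η (rkPerm ν)
    have h2 : (∑ i, (ν i : ℤ) * rk ν i) ≤ ∑ i, (ν i : ℤ) * rk η (ρ i) := by
      exact_mod_cast sum_mul_rk_le ν (ρ.trans (rkPerm η))
    simp only [sub_mul, mul_sub, Finset.sum_sub_distrib]
    linarith
  have hz := (Finset.sum_eq_zero_iff_of_nonneg (fun i _ => hpos i)).1
    (le_antisymm hsum (Finset.sum_nonneg fun i _ => hpos i))
  funext i
  have hi := hz i (Finset.mem_univ i)
  rcases lt_trichotomy (ν i) (η i) with hl | hl | hl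
  · have := hlt i hl
    rcases mul_eq_zero.1 hi with h0 | h0 <;> omega
  · exact hl
  · have := hgt i hl
    rcases mul_eq_zero.1 hi with h0 | h0 <;> omega

/-- The joint spectrum of the Cherednik operators is simple. -/
theorem eig_injective [CharZero K] {α : K}
    (hα : ∀ a b : ℕ, 0 < a → (a : K) * α + (b : K) ≠ 0) {η ν : Fin (n + 1) → ℕ}
    (h : ∀ i, eig α η i = eig α ν i) : η = ν :=
  eq_of_eig_eq_comp hα 1 (fun _ => rfl) h

theorem simple_val (k : Fin n) (p : Fin (n + 1)) : (simple k p : ℕ)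
    = if (p : ℕ) = k then (k : ℕ) + 1 else if (p : ℕ) = k + 1 then (k : ℕ) else p := by
  split_ifs with h1 h2
  · have : p = k.castSucc := Fin.ext h1
    rw [this, simple_castSucc, Fin.val_succ]
  · have : p = k.succ := Fin.ext h2
    rw [this, simple_succ, Fin.val_castSucc]
  · rw [simple_of_ne (fun h => h1 (by simp [h])) (fun h => h2 (by simp [h]))]

theorem act_simple (k : Fin n) (η : Fin (n + 1) → ℕ) (i : Fin (n + 1)) :
    act (simple k) η i = η (simple k i) := by rw [act, simple_inv]

theorem act_simple_simple (k : Fin n) (η : Fin (n + 1) → ℕ) :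
    act (simple k) (act (simple k) η) = η := by
  funext i
  rw [act_simple, act_simple, simple_simple]

theorem act_simple_castSucc (k : Fin n) (η : Fin (n + 1) → ℕ) :
    act (simple k) η k.castSucc = η k.succ := by rw [act_simple, simple_castSucc]

theorem act_simple_succ (k : Fin n) (η : Fin (n + 1) → ℕ) :
    act (simple k) η k.succ = η k.castSucc := by rw [act_simple, simple_succ]

theorem act_simple_of_eq {k : Fin n} {η : Fin (n + 1) → ℕ} (h : η k.castSucc = η k.succ) :
    act (simple k) η = η := by
  funext i
  rw [act_simple]
  by_cases h1 : i = k.castSucc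
  · rw [h1, simple_castSucc, h]
  by_cases h2 : i = k.succ
  · rw [h2, simple_succ, h]
  rw [simple_of_ne h1 h2]

theorem act_mul (v w : Equiv.Perm (Fin (n + 1))) (η : Fin (n + 1) → ℕ) :
    act (v * w) η = act v (act w η) := by
  funext i
  simp [act, mul_inv_rev]

theorem act_one (η : Fin (n + 1) → ℕ) : act 1 η = η := by
  funext i
  simp [act]

/-- A simple transposition preserves the relative order of all pairs but one. -/
theorem simple_lt_simple_iff {k : Fin n} {p q : Fin (n + 1)}
    (h1 : ¬(p = k.castSucc ∧ q = k.succ)) (h2 : ¬(p = k.succ ∧ q = k.castSucc)) :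
    simple k p < simple k q ↔ p < q := by
  simp only [Fin.lt_def, Fin.ext_iff, simple_val, Fin.val_castSucc, Fin.val_succ] at *
  split_ifs <;> omega

/-- Ties are broken by position, and `s_k` changes the relative order of positions `k` and `k + 1`
only; these do not tie when their entries differ. -/
theorem rk_act_simple {k : Fin n} {η : Fin (n + 1) → ℕ} (h : η k.castSucc ≠ η k.succ)
    (j : Fin (n + 1)) : rk (act (simple k) η) j = rk η (simple k j) := by
  refine Finset.card_bij (fun p _ => simple k p) ?_ (fun p _ q _ h => (simple k).injective h) ?_
  · intro p hp
    simp only [Finset.mem_filter, Finset.mem_univ, true_and, act_simple] at hp ⊢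
    refine hp.imp_right fun ⟨h1, h2⟩ => ⟨h1, (simple_lt_simple_iff ?_ ?_).2 h2⟩
    · rintro ⟨rfl, rfl⟩
      rw [simple_castSucc, simple_succ] at h1
      exact h h1.symm
    · rintro ⟨rfl, rfl⟩
      rw [simple_castSucc, simple_succ] at h1
      exact h h1
  · intro p hp
    refine ⟨simple k p, ?_, simple_simple k p⟩
    simp only [Finset.mem_filter, Finset.mem_univ, true_and, act_simple, simple_simple] at hp ⊢
    refine hp.imp_right fun ⟨h1, h2⟩ => ⟨h1, ?_⟩
    rw [← simple_simple k j, simple_lt_simple_iff]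
    · exact h2
    · rintro ⟨rfl, h3⟩
      rw [h3] at h1
      exact h h1
    · rintro ⟨rfl, h3⟩
      rw [h3] at h1
      exact h h1.symm

theorem eig_act_simple (α : K) {k : Fin n} {η : Fin (n + 1) → ℕ} (h : η k.castSucc ≠ η k.succ)
    (j : Fin (n + 1)) : eig α (act (simple k) η) j = eig α η (simple k j) := by
  rw [eig_eq_rk, eig_eq_rk, rk_act_simple h, act_simple]

theorem rk_succ_of_eq {k : Fin n} {η : Fin (n + 1) → ℕ} (h : η k.castSucc = η k.succ) :
    rk η k.succ = rk η k.castSucc + 1 := by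
  have : Finset.univ.filter (fun p => η k.succ < η p ∨ (η p = η k.succ ∧ p < k.succ))
      = insert k.castSucc (Finset.univ.filter
        (fun p => η k.castSucc < η p ∨ (η p = η k.castSucc ∧ p < k.castSucc))) := by
    ext p
    by_cases hp : p = k.castSucc
    · subst hp
      simp [h]
    · simp only [Finset.mem_filter, Finset.mem_univ, true_and, Finset.mem_insert, hp, false_or]
      simp only [Fin.lt_def, Fin.ext_iff, Fin.val_castSucc, Fin.val_succ] at *
      omega
  rw [rk, rk, this, Finset.card_insert_of_notMem (by simp)]

theorem eig_sub_of_eq (α : K) {k : Fin n} {η : Fin (n + 1) → ℕ}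
    (h : η k.castSucc = η k.succ) : eig α η k.castSucc - eig α η k.succ = 1 := by
  rw [eig_eq_rk, eig_eq_rk, rk_succ_of_eq h, h]
  push_cast
  ring

theorem leg_eq_card (η : Fin (n + 1) → ℕ) (i : Fin (n + 1)) (j : ℕ) :
    leg η i j = (Finset.univ.filter (fun k => (k < i ∧ j ≤ η k + 1 ∧ η k + 1 ≤ η i)
      ∨ (i < k ∧ j ≤ η k ∧ η k ≤ η i))).card := by
  rw [leg, ← Finset.card_union_of_disjoint]
  · congr 1
    ext k
    simp
  · refine Finset.disjoint_left.2 fun p h1 h2 => ?_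
    simp only [Finset.mem_filter, Finset.mem_Iio, Finset.mem_Ioi] at h1 h2
    exact lt_asymm h1.1 h2.1

theorem leg_act_simple (k : Fin n) (η : Fin (n + 1) → ℕ) (i : Fin (n + 1)) (j : ℕ) :
    leg (act (simple k) η) (simple k i) j
      = (Finset.univ.filter (fun q => (simple k q < simple k i ∧ j ≤ η q + 1 ∧ η q + 1 ≤ η i)
      ∨ (simple k i < simple k q ∧ j ≤ η q ∧ η q ≤ η i))).card := by
  rw [leg_eq_card]
  refine Finset.card_bij (fun p _ => simple k p) ?_ (fun p _ q _ h => (simple k).injective h) ?_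
  · intro p hp
    simpa only [Finset.mem_filter, Finset.mem_univ, true_and, act_simple, simple_simple] using hp
  · intro p hp
    refine ⟨simple k p, ?_, simple_simple k p⟩
    simpa only [Finset.mem_filter, Finset.mem_univ, true_and, act_simple, simple_simple] using hp

/-- Only the pair of rows `k`, `k + 1` can be counted differently. The shift by 1 in the condition
for earlier rows compensates the exchange except at the one box excluded here. -/
theorem leg_act_simple_of_ne {k : Fin n} {η : Fin (n + 1) → ℕ} (h : η k.succ < η k.castSucc)
    {i : Fin (n + 1)} {j : ℕ} (hij : ¬(i = k.castSucc ∧ j = η k.succ + 1)) :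
    leg (act (simple k) η) (simple k i) j = leg η i j := by
  rw [leg_act_simple, leg_eq_card]
  congr 1
  refine Finset.filter_congr fun q _ => ?_
  by_cases h1 : q = k.castSucc ∧ i = k.succ
  · obtain ⟨rfl, rfl⟩ := h1
    simp only [simple_castSucc, simple_succ, Fin.castSucc_lt_succ, Fin.castSucc_lt_succ.not_gt,
      true_and, false_and, false_or, or_false]
    omega
  by_cases h2 : q = k.succ ∧ i = k.castSucc
  · obtain ⟨rfl, rfl⟩ := h2
    simp only [simple_castSucc, simple_succ, Fin.castSucc_lt_succ, Fin.castSucc_lt_succ.not_gt,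
      true_and, false_and, false_or, or_false]
    simp only [true_and] at hij
    omega
  rw [simple_lt_simple_iff h1 h2, simple_lt_simple_iff (fun h => h2 h.symm) (fun h => h1 h.symm)]

theorem leg_act_simple_corner {k : Fin n} {η : Fin (n + 1) → ℕ} (h : η k.succ < η k.castSucc) :
    leg (act (simple k) η) k.succ (η k.succ + 1) = leg η k.castSucc (η k.succ + 1) + 1 := by
  have := leg_act_simple k η k.castSucc (η k.succ + 1)
  rw [simple_castSucc] at this
  rw [this, leg_eq_card, ← Finset.card_insert_of_notMem (a := k.succ)]
  · congr 1
    ext q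
    by_cases hq : q = k.succ
    · subst hq
      simp only [simple_succ, Fin.castSucc_lt_succ, Finset.mem_filter, Finset.mem_univ, true_and,
        Finset.mem_insert, true_or, iff_true]
      omega
    · have h1 : simple k q < k.succ ↔ q < k.castSucc := by
        rw [← simple_castSucc k, simple_lt_simple_iff
          (fun h => Fin.castSucc_lt_succ.ne h.2) (fun h => hq h.1)]
      have h2 : k.succ < simple k q ↔ k.castSucc < q := by
        rw [← simple_castSucc k, simple_lt_simple_iff (fun h => hq h.2)
          (fun h => Fin.castSucc_lt_succ.ne h.1)]
      simp [hq, h1, h2]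
  · simp [Fin.castSucc_lt_succ.not_gt]

/-- The positions ranked before `k + 1` are those ranked before `k`, position `k` itself, and those
with rank strictly between; the last are what the leg of this box counts. This identifies
differences of eigenvalues with the factors of `d` and `d'`. -/
theorem rk_succ_eq_leg {k : Fin n} {η : Fin (n + 1) → ℕ} (h : η k.succ < η k.castSucc) :
    rk η k.succ = rk η k.castSucc + leg η k.castSucc (η k.succ + 1) + 1 := by
  rw [leg_eq_card, rk, rk, ← Finset.card_union_of_disjoint,
    ← Finset.card_insert_of_notMem (a := k.castSucc)]
  · congr 1
    ext p
    simp only [Finset.mem_filter, Finset.mem_univ, true_and, Finset.mem_insert, Finset.mem_union]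
    by_cases hp : p = k.castSucc
    · subst hp
      simp [h]
    by_cases hp' : p = k.succ
    · subst hp'
      simp [h.not_gt, Fin.castSucc_lt_succ.not_gt, Fin.castSucc_lt_succ.ne']
    · simp only [Fin.lt_def, Fin.ext_iff, Fin.val_castSucc, Fin.val_succ] at *
      omega
  · simp
  · refine Finset.disjoint_left.2 fun p h1 h2 => ?_
    simp only [Finset.mem_filter, Finset.mem_univ, true_and, Fin.lt_def] at h1 h2
    omega

/-- A product over the boxes of `η` of a function of arm and leg lengths. -/
def boxProd (F : ℕ → ℕ → K) (η : Fin (n + 1) → ℕ) : K :=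
  ∏ i, ∏ j ∈ Finset.Icc 1 (η i), F (arm η i j) (leg η i j)

/-- Matching boxes along `s_k`, all factors agree except the one at the special box, whose leg grows
by 1. Stated without division because that factor may vanish for a general `F`. -/
theorem boxProd_act_simple (F : ℕ → ℕ → K) {k : Fin n} {η : Fin (n + 1) → ℕ}
    (h : η k.succ < η k.castSucc) :
    boxProd F (act (simple k) η) * F (arm η k.castSucc (η k.succ + 1))
        (leg η k.castSucc (η k.succ + 1))
      = boxProd F η * F (arm η k.castSucc (η k.succ + 1))
        (leg η k.castSucc (η k.succ + 1) + 1) := by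
  have harm : ∀ i j, arm (act (simple k) η) (simple k i) j = arm η i j := fun i j => by
    rw [arm, arm, act_simple, simple_simple]
  have hmem : η k.succ + 1 ∈ Finset.Icc 1 (η k.castSucc) := Finset.mem_Icc.2 (by omega)
  have h1 : boxProd F (act (simple k) η)
      = ∏ i, ∏ j ∈ Finset.Icc 1 (η i), F (arm η i j) (leg (act (simple k) η) (simple k i) j) := by
    rw [boxProd, ← Equiv.prod_comp (simple k)]
    refine Finset.prod_congr rfl fun i _ => ?_
    rw [act_simple, simple_simple]
    exact Finset.prod_congr rfl fun j _ => by rw [harm]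
  rw [h1, boxProd, ← Finset.mul_prod_erase _ _ (Finset.mem_univ k.castSucc),
    ← Finset.mul_prod_erase _ _ hmem, ← Finset.mul_prod_erase _ _ (Finset.mem_univ k.castSucc),
    ← Finset.mul_prod_erase _ _ hmem, simple_castSucc, leg_act_simple_corner h]
  have h2 : ∏ x ∈ (Finset.Icc 1 (η k.castSucc)).erase (η k.succ + 1),
      F (arm η k.castSucc x) (leg (act (simple k) η) k.succ x)
      = ∏ x ∈ (Finset.Icc 1 (η k.castSucc)).erase (η k.succ + 1),
      F (arm η k.castSucc x) (leg η k.castSucc x) := by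
    refine Finset.prod_congr rfl fun j hj => ?_
    rw [← leg_act_simple_of_ne h (i := k.castSucc) fun h => Finset.ne_of_mem_erase hj h.2,
      simple_castSucc]
  have h3 : ∏ x ∈ Finset.univ.erase k.castSucc, ∏ j ∈ Finset.Icc 1 (η x),
      F (arm η x j) (leg (act (simple k) η) (simple k x) j)
      = ∏ x ∈ Finset.univ.erase k.castSucc, ∏ j ∈ Finset.Icc 1 (η x),
      F (arm η x j) (leg η x j) := by
    refine Finset.prod_congr rfl fun i hi => Finset.prod_congr rfl fun j _ => ?_
    rw [leg_act_simple_of_ne h fun h => Finset.ne_of_mem_erase hi h.1]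
  rw [h2, h3]
  ring

theorem dd_eq_boxProd (α : K) (η : Fin (n + 1) → ℕ) :
    dd α η = boxProd (fun a l => α * ((a : K) + 1) + (l : K) + 1) η := rfl

theorem dd'_eq_boxProd (α : K) (η : Fin (n + 1) → ℕ) :
    dd' α η = boxProd (fun a l => α * ((a : K) + 1) + (l : K)) η := rfl

theorem eig_sub_of_gt (α : K) {k : Fin n} {η : Fin (n + 1) → ℕ} (h : η k.succ < η k.castSucc) :
    eig α η k.castSucc - eig α η k.succ = α * ((arm η k.castSucc (η k.succ + 1) : K) + 1)
      + (leg η k.castSucc (η k.succ + 1) : K) + 1 := by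
  rw [eig_eq_rk, eig_eq_rk, rk_succ_eq_leg h, arm, Nat.cast_sub (by omega)]
  push_cast
  ring

theorem dd_act_simple (α : K) {k : Fin n} {η : Fin (n + 1) → ℕ} (h : η k.succ < η k.castSucc) :
    dd α (act (simple k) η) * (eig α η k.castSucc - eig α η k.succ)
      = dd α η * (eig α η k.castSucc - eig α η k.succ + 1) := by
  have := boxProd_act_simple (fun a l => α * ((a : K) + 1) + (l : K) + 1) h
  rw [dd_eq_boxProd, dd_eq_boxProd, eig_sub_of_gt α h, this]
  push_cast
  ring

theorem dd'_act_simple (α : K) {k : Fin n} {η : Fin (n + 1) → ℕ}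
    (h : η k.succ < η k.castSucc) :
    dd' α (act (simple k) η) * (eig α η k.castSucc - eig α η k.succ - 1)
      = dd' α η * (eig α η k.castSucc - eig α η k.succ) := by
  have := boxProd_act_simple (fun a l => α * ((a : K) + 1) + (l : K)) h
  rw [dd'_eq_boxProd, dd'_eq_boxProd, eig_sub_of_gt α h, add_sub_cancel_right, this]
  push_cast
  ring

section Nonvanishing

variable {α : K}

theorem arm_leg_ne_zero (hα : ∀ a b : ℕ, 0 < a → (a : K) * α + (b : K) ≠ 0)
    (a l : ℕ) : α * ((a : K) + 1) + (l : K) ≠ 0 := by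
  have := hα (a + 1) l (by omega)
  rw [mul_comm]
  exact_mod_cast this

theorem dd_ne_zero (hα : ∀ a b : ℕ, 0 < a → (a : K) * α + (b : K) ≠ 0)
    (η : Fin (n + 1) → ℕ) : dd α η ≠ 0 :=
  Finset.prod_ne_zero_iff.2 fun i _ => Finset.prod_ne_zero_iff.2 fun j _ => by
    have := arm_leg_ne_zero hα (arm η i j) (leg η i j + 1)
    rwa [Nat.cast_add, Nat.cast_one, ← add_assoc] at this

theorem dd'_ne_zero (hα : ∀ a b : ℕ, 0 < a → (a : K) * α + (b : K) ≠ 0)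
    (η : Fin (n + 1) → ℕ) : dd' α η ≠ 0 :=
  Finset.prod_ne_zero_iff.2 fun _ _ => Finset.prod_ne_zero_iff.2 fun _ _ =>
    arm_leg_ne_zero hα _ _

theorem eig_sub_ne_of_gt (hα : ∀ a b : ℕ, 0 < a → (a : K) * α + (b : K) ≠ 0)
    {k : Fin n} {η : Fin (n + 1) → ℕ} (h : η k.succ < η k.castSucc) :
    eig α η k.castSucc - eig α η k.succ ≠ 0 ∧ eig α η k.castSucc - eig α η k.succ - 1 ≠ 0 ∧
      eig α η k.castSucc - eig α η k.succ + 1 ≠ 0 := by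
  rw [eig_sub_of_gt α h]
  set a := arm η k.castSucc (η k.succ + 1)
  set l := leg η k.castSucc (η k.succ + 1)
  have h0 := arm_leg_ne_zero hα a l
  have h1 := arm_leg_ne_zero hα a (l + 1)
  have h2 := arm_leg_ne_zero hα a (l + 2)
  push_cast at h1 h2
  refine ⟨?_, ?_, ?_⟩
  · rwa [← add_assoc] at h1
  · rwa [add_sub_cancel_right]
  · convert h2 using 1
    ring

theorem eig_sub_ne_zero (hα : ∀ a b : ℕ, 0 < a → (a : K) * α + (b : K) ≠ 0)
    {k : Fin n} (η : Fin (n + 1) → ℕ) :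
    eig α η k.castSucc - eig α η k.succ ≠ 0 := by
  rcases lt_trichotomy (η k.succ) (η k.castSucc) with h | h | h
  · exact (eig_sub_ne_of_gt hα h).1
  · rw [eig_sub_of_eq α h.symm]
    exact one_ne_zero
  · have h' : act (simple k) η k.succ < act (simple k) η k.castSucc := by
      rwa [act_simple_castSucc, act_simple_succ]
    have := (eig_sub_ne_of_gt hα h').1
    rw [eig_act_simple α h.ne, eig_act_simple α h.ne, simple_castSucc, simple_succ] at this
    rw [← neg_sub]
    exact neg_ne_zero.2 this

/-- Excluding `δ = ±1` keeps the intertwiner invertible between distinct compositions. -/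
theorem eig_sub_ne_of_ne (hα : ∀ a b : ℕ, 0 < a → (a : K) * α + (b : K) ≠ 0)
    {k : Fin n} {η : Fin (n + 1) → ℕ} (h : η k.castSucc ≠ η k.succ) :
    eig α η k.castSucc - eig α η k.succ - 1 ≠ 0 ∧
      eig α η k.castSucc - eig α η k.succ + 1 ≠ 0 := by
  rcases lt_or_gt_of_ne h with h' | h'
  · have h'' : act (simple k) η k.succ < act (simple k) η k.castSucc := by
      rwa [act_simple_castSucc, act_simple_succ]
    have := (eig_sub_ne_of_gt hα h'').2
    rw [eig_act_simple α h, eig_act_simple α h, simple_castSucc, simple_succ] at this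
    refine ⟨fun h0 => this.2 ?_, fun h0 => this.1 ?_⟩ <;> linear_combination - h0
  · exact (eig_sub_ne_of_gt hα h').2

end Nonvanishing

/-- The raising operation on compositions. -/
def raiseComp (η : Fin (n + 1) → ℕ) : Fin (n + 1) → ℕ :=
  fun i => η (finRotate (n + 1) i) + if i = Fin.last n then 1 else 0

/-- The first entry becomes last and gains 1. It came first among equals before, and now exceeds
them, while an entry larger by 1 preceded it before and still wins the tie by position. -/
theorem rk_raiseComp (η : Fin (n + 1) → ℕ) (i : Fin (n + 1)) :
    rk (raiseComp η) i = rk η (finRotate (n + 1) i) := by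
  have hv : ∀ i : Fin (n + 1), (finRotate (n + 1) i : ℕ) = if (i : ℕ) = n then 0 else (i : ℕ) + 1 := by
    intro i
    rw [coe_finRotate]
    simp [Fin.ext_iff]
  have key : ∀ p : Fin (n + 1), (raiseComp η i < raiseComp η p ∨
      (raiseComp η p = raiseComp η i ∧ p < i)) ↔
      (η (finRotate (n + 1) i) < η (finRotate (n + 1) p) ∨
        (η (finRotate (n + 1) p) = η (finRotate (n + 1) i)
          ∧ finRotate (n + 1) p < finRotate (n + 1) i)) := by
    intro p
    have hp := p.2
    have hi := i.2
    have hlast : ∀ i : Fin (n + 1), i = Fin.last n ↔ (i : ℕ) = n := fun i => by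
      rw [Fin.ext_iff, Fin.val_last]
    simp only [raiseComp, Fin.lt_def, hv, hlast]
    by_cases hpi : p = i
    · subst hpi; simp
    have hpi : (p : ℕ) ≠ i := fun h => hpi (Fin.ext h)
    split_ifs <;> omega
  refine Finset.card_bij (fun p _ => finRotate (n + 1) p) ?_
    (fun p _ q _ h => (finRotate (n + 1)).injective h) ?_
  · intro p hp
    simp only [Finset.mem_filter, Finset.mem_univ, true_and] at hp ⊢
    exact (key p).1 hp
  · intro p hp
    refine ⟨(finRotate (n + 1)).symm p, ?_, Equiv.apply_symm_apply _ _⟩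
    simp only [Finset.mem_filter, Finset.mem_univ, true_and] at hp ⊢
    rw [key, Equiv.apply_symm_apply]
    exact hp

theorem eig_raiseComp_last (α : K) (η : Fin (n + 1) → ℕ) :
    eig α (raiseComp η) (Fin.last n) = eig α η 0 + α := by
  rw [eig_eq_rk, eig_eq_rk, rk_raiseComp, raiseComp, if_pos rfl, finRotate_last]
  push_cast
  ring

theorem eig_raiseComp_castSucc (α : K) (η : Fin (n + 1) → ℕ) (j : Fin n) :
    eig α (raiseComp η) j.castSucc = eig α η j.succ := by
  rw [eig_eq_rk, eig_eq_rk, rk_raiseComp, raiseComp, if_neg (Fin.castSucc_ne_last j),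
    finRotate_apply, Fin.coeSucc_eq_succ, add_zero]

theorem exists_eq_raiseComp {η : Fin (n + 1) → ℕ} (h : 0 < η (Fin.last n)) :
    ∃ ν, η = raiseComp ν ∧ ∑ i, ν i + 1 = ∑ i, η i := by
  -- The truncated subtraction is harmless: at index 0 it acts on the last entry of `η`, which is
  -- positive.
  have h1 : η = raiseComp
      (fun i => η ((finRotate (n + 1)).symm i) - if i = 0 then 1 else 0) := by
    funext i
    simp only [raiseComp, Equiv.symm_apply_apply]
    by_cases hi : i = Fin.last n
    · subst hi
      simp only [finRotate_last, if_true]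
      omega
    · have : finRotate (n + 1) i ≠ 0 := fun h => hi ((finRotate (n + 1)).injective
        (h.trans finRotate_last.symm))
      rw [if_neg hi, if_neg this, add_zero, Nat.sub_zero]
  refine ⟨_, h1, ?_⟩
  conv_rhs => rw [h1]
  simp only [raiseComp]
  rw [Finset.sum_add_distrib, Equiv.sum_comp (finRotate (n + 1)) (fun i =>
    η ((finRotate (n + 1)).symm i) - if i = 0 then 1 else 0)]
  simp

end Ranks

/-! ### The dominance orders on partitions and compositions. -/

section Order

variable {n : ℕ}

theorem eq_of_partial_sums {η ν : Fin (n + 1) → ℕ}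
    (h : ∀ p, ∑ j ∈ Finset.Iic p, η j = ∑ j ∈ Finset.Iic p, ν j) : η = ν := by
  funext p
  have h1 : Finset.Iic p = insert p (Finset.Iio p) := by
    ext q
    simp [le_iff_eq_or_lt]
  have h2 : ∑ j ∈ Finset.Iio p, η j = ∑ j ∈ Finset.Iio p, ν j := by
    rcases p.eq_zero_or_eq_succ with rfl | ⟨q, rfl⟩
    · have : Finset.Iio (0 : Fin (n + 1)) = ∅ := by
        ext q
        simp
      rw [this, Finset.sum_empty, Finset.sum_empty]
    · have : Finset.Iio q.succ = Finset.Iic q.castSucc := by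
        ext r
        simp only [Finset.mem_Iio, Finset.mem_Iic, Fin.lt_def, Fin.le_def, Fin.val_succ,
          Fin.val_castSucc]
        omega
      rw [this, h]
  have := h p
  rw [h1, Finset.sum_insert (by simp), Finset.sum_insert (by simp), h2] at this
  omega

theorem DomLt.trans {η ν μ : Fin (n + 1) → ℕ} (h1 : DomLt η ν) (h2 : DomLt ν μ) : DomLt η μ := by
  refine ⟨?_, h1.2.1.trans h2.2.1, fun p => (h1.2.2 p).trans (h2.2.2 p)⟩
  rintro rfl
  exact h1.1 (eq_of_partial_sums fun p => le_antisymm (h1.2.2 p) (h2.2.2 p))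

theorem Prec.trans {η ν μ : Fin (n + 1) → ℕ} (h1 : Prec η ν) (h2 : Prec ν μ) : Prec η μ := by
  rcases h1 with h1 | ⟨h1, h1'⟩ <;> rcases h2 with h2 | ⟨h2, h2'⟩
  · exact Or.inl (h1.trans h2)
  · exact Or.inl (h2 ▸ h1)
  · exact Or.inl (h1 ▸ h2)
  · exact Or.inr ⟨h1.trans h2, h1'.trans h2'⟩

theorem Prec.irrefl (η : Fin (n + 1) → ℕ) : ¬Prec η η := by
  rintro (h | ⟨_, h⟩) <;> exact h.1 rfl

theorem Prec.ne {η ν : Fin (n + 1) → ℕ} (h : Prec η ν) : η ≠ ν := by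
  rintro rfl
  exact Prec.irrefl _ h

/-- In a finite set of compositions every element lies below a maximal one. -/
theorem exists_maximal_prec (s : Finset (Fin (n + 1) → ℕ)) {x : Fin (n + 1) → ℕ} (hx : x ∈ s) :
    ∃ m ∈ s, (x = m ∨ Prec x m) ∧ ∀ y ∈ s, ¬Prec m y := by
  classical
  let r : s → s → Prop := fun a b => Prec (b : Fin (n + 1) → ℕ) a
  have : IsTrans s r := ⟨fun a b c h1 h2 => h2.trans h1⟩
  have : Std.Irrefl r := ⟨fun a => Prec.irrefl _⟩
  have hwf : WellFounded r := Finite.wellFounded_of_trans_of_irrefl r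
  obtain ⟨m, hm, hmin⟩ := hwf.has_min
    {y : s | x = y ∨ Prec x (y : Fin (n + 1) → ℕ)} ⟨⟨x, hx⟩, Or.inl rfl⟩
  refine ⟨m, m.2, hm, fun y hy hlt => hmin ⟨y, hy⟩ (Or.inr ?_) hlt⟩
  rcases hm with hm | hm
  · exact hm ▸ hlt
  · exact Prec.trans hm hlt

/-- Comparison of sums over two sets of the same size by means of a separating value. -/
theorem sum_le_sum_of_separated {ι : Type*} [DecidableEq ι] {f : ι → ℕ} {S T : Finset ι}
    (hc : S.card = T.card) (c : ℕ) (hS : ∀ x ∈ S, x ∉ T → f x ≤ c)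
    (hT : ∀ y ∈ T, y ∉ S → c ≤ f y) : ∑ x ∈ S, f x ≤ ∑ x ∈ T, f x := by
  have h1 := Finset.sum_inter_add_sum_sdiff S T f
  have h2 := Finset.sum_inter_add_sum_sdiff T S f
  have hc' : (S \ T).card = (T \ S).card := by
    have h3 := Finset.card_inter_add_card_sdiff S T
    have h4 := Finset.card_inter_add_card_sdiff T S
    rw [Finset.inter_comm] at h4
    omega
  have h5 : ∑ x ∈ S \ T, f x ≤ (S \ T).card * c :=
    Finset.sum_le_card_nsmul _ _ _ fun x hx =>
      hS x (Finset.mem_sdiff.1 hx).1 (Finset.mem_sdiff.1 hx).2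
  have h6 : (T \ S).card * c ≤ ∑ x ∈ T \ S, f x :=
    Finset.card_nsmul_le_sum _ _ _ fun x hx =>
      hT x (Finset.mem_sdiff.1 hx).1 (Finset.mem_sdiff.1 hx).2
  rw [Finset.inter_comm] at h2
  rw [hc'] at h5
  omega

theorem antitone_plus (η : Fin (n + 1) → ℕ) : Antitone (plus η) := fun _ _ h =>
  Tuple.monotone_sort η (Fin.rev_le_rev.2 h)

theorem plus_act (w : Equiv.Perm (Fin (n + 1))) (η : Fin (n + 1) → ℕ) :
    plus (act w η) = plus η := by
  funext i
  exact congrFun (Tuple.comp_perm_comp_sort_eq_comp_sort (f := η) (σ := w⁻¹)) i.rev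

/-- The permutation sorting a composition in decreasing order. -/
def plusPerm (η : Fin (n + 1) → ℕ) : Equiv.Perm (Fin (n + 1)) :=
  Fin.revPerm.trans (Tuple.sort η)

theorem plus_eq_plusPerm (η : Fin (n + 1) → ℕ) (i : Fin (n + 1)) : plus η i = η (plusPerm η i) :=
  rfl

theorem sum_comp_plus (g : ℕ → ℕ) (η : Fin (n + 1) → ℕ) : ∑ i, g (plus η i) = ∑ i, g (η i) :=
  Equiv.sum_comp (plusPerm η) fun i => g (η i)

/-- With `exists_sum_eq_sum_plus`, this identifies partial sums of `η⁺` with maxima of sums of `η`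
over sets of a given size, so dominance can be tested without sorting. -/
theorem sum_le_sum_plus (η : Fin (n + 1) → ℕ) (p : Fin (n + 1)) (S : Finset (Fin (n + 1)))
    (hS : S.card = (Finset.Iic p).card) : ∑ i ∈ S, η i ≤ ∑ j ∈ Finset.Iic p, plus η j := by
  have h1 : ∑ i ∈ S, η i = ∑ j ∈ S.map (plusPerm η).symm.toEmbedding, plus η j := by
    simp [Finset.sum_map, plus_eq_plusPerm]
  rw [h1]
  refine sum_le_sum_of_separated (by rw [Finset.card_map, hS]) (plus η p) ?_ ?_
  · intro x _ hx
    exact antitone_plus η (by simpa using hx : p < x).le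
  · intro x hx _
    exact antitone_plus η (by simpa using hx)

theorem exists_sum_eq_sum_plus (η : Fin (n + 1) → ℕ) (p : Fin (n + 1)) :
    ∃ S : Finset (Fin (n + 1)), S.card = (Finset.Iic p).card ∧
      ∑ j ∈ Finset.Iic p, plus η j = ∑ i ∈ S, η i :=
  ⟨(Finset.Iic p).map (plusPerm η).toEmbedding, by rw [Finset.card_map], by
    simp [Finset.sum_map, plus_eq_plusPerm]⟩

/-- Replace the entries at `i` and `p`. -/
def upd₂ (μ : Fin (n + 1) → ℕ) (i p : Fin (n + 1)) (x y : ℕ) : Fin (n + 1) → ℕ :=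
  fun k => if k = i then x else if k = p then y else μ k

theorem sum_upd₂ {μ : Fin (n + 1) → ℕ} {i p : Fin (n + 1)} (hip : i ≠ p) (x y : ℕ) (g : ℕ → ℕ) :
    ∑ k, g (upd₂ μ i p x y k) = g x + g y + ∑ k ∈ (Finset.univ.erase i).erase p, g (μ k) := by
  have hp : p ∈ Finset.univ.erase i := Finset.mem_erase.2 ⟨hip.symm, Finset.mem_univ _⟩
  rw [← Finset.add_sum_erase _ _ (Finset.mem_univ i), ← Finset.add_sum_erase _ _ hp, ← add_assoc]
  congr 1
  · simp [upd₂, hip.symm]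
  · refine Finset.sum_congr rfl fun k hk => ?_
    rw [upd₂, if_neg (Finset.ne_of_mem_erase (Finset.mem_of_mem_erase hk)),
      if_neg (Finset.ne_of_mem_erase hk)]

theorem upd₂_self (μ : Fin (n + 1) → ℕ) (i p : Fin (n + 1)) : upd₂ μ i p (μ i) (μ p) = μ := by
  funext k
  rw [upd₂]
  split_ifs with h1 h2
  · rw [h1]
  · rw [h2]
  · rfl

/-- Moving two entries strictly towards each other decreases the associated partition. -/
theorem domLt_plus_upd₂ {μ : Fin (n + 1) → ℕ} {i p : Fin (n + 1)} (hip : i ≠ p) {x y : ℕ}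
    (hsum : x + y = μ i + μ p) (hx : μ p < x) (hy : μ p < y) :
    DomLt (plus (upd₂ μ i p x y)) (plus μ) := by
  refine ⟨fun h => ?_, ?_, fun q => ?_⟩
  · have h1 := sum_comp_plus (fun t => t ^ 2) (upd₂ μ i p x y)
    rw [h, sum_comp_plus (fun t => t ^ 2)] at h1
    have h2 := sum_upd₂ hip x y (μ := μ) (fun t => t ^ 2)
    have h3 := sum_upd₂ hip (μ i) (μ p) (μ := μ) (fun t => t ^ 2)
    rw [upd₂_self] at h3
    have h4 : x ^ 2 + y ^ 2 = μ i ^ 2 + μ p ^ 2 := by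
      omega
    obtain ⟨a, rfl⟩ := Nat.exists_eq_add_of_lt hx
    obtain ⟨b, rfl⟩ := Nat.exists_eq_add_of_lt hy
    have h5 : μ i = μ p + a + b + 2 := by omega
    rw [h5] at h4
    nlinarith
  · have h0 := sum_comp_plus id (upd₂ μ i p x y)
    have h1 := sum_comp_plus id μ
    have h2 := sum_upd₂ hip x y (μ := μ) id
    have h3 := sum_upd₂ hip (μ i) (μ p) (μ := μ) id
    rw [upd₂_self] at h3
    simp only [id] at *
    omega
  -- Take an optimal set for the new composition. If it contains `p` but not `i`, exchange `p` for
  -- `i`; otherwise keep it. Both `x` and `y` are below `μ i`, so the sum does not decrease.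
  · obtain ⟨S, hS, hSs⟩ := exists_sum_eq_sum_plus (upd₂ μ i p x y) q
    rw [hSs]
    have hle : ∀ T : Finset (Fin (n + 1)), i ∉ T → p ∉ T →
        ∑ k ∈ T, upd₂ μ i p x y k = ∑ k ∈ T, μ k := fun T h1 h2 =>
      Finset.sum_congr rfl fun k hk => by
        rw [upd₂, if_neg (ne_of_mem_of_not_mem hk h1), if_neg (ne_of_mem_of_not_mem hk h2)]
    have hui : upd₂ μ i p x y i = x := by simp [upd₂]
    have hup : upd₂ μ i p x y p = y := by simp [upd₂, hip.symm]
    by_cases h1 : i ∈ S <;> by_cases h2 : p ∈ S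
    · refine le_trans (le_of_eq ?_) (sum_le_sum_plus μ q S hS)
      have h2' : p ∈ S.erase i := Finset.mem_erase.2 ⟨hip.symm, h2⟩
      rw [← Finset.add_sum_erase _ _ h1, ← Finset.add_sum_erase _ _ h2',
        ← Finset.add_sum_erase _ μ h1, ← Finset.add_sum_erase _ μ h2',
        hle _ (by simp) (by simp), hui, hup]
      omega
    · refine le_trans ?_ (sum_le_sum_plus μ q S hS)
      rw [← Finset.add_sum_erase _ _ h1, ← Finset.add_sum_erase _ μ h1,
        hle _ (by simp) (by simp [h2]), hui]
      omega
    · have hi' : i ∉ S.erase p := fun h => h1 (Finset.mem_of_mem_erase h)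
      have hc : (insert i (S.erase p)).card = (Finset.Iic q).card := by
        rw [Finset.card_insert_of_notMem hi', ← hS, Finset.card_erase_add_one h2]
      refine le_trans ?_ (sum_le_sum_plus μ q _ hc)
      rw [Finset.sum_insert hi', ← Finset.add_sum_erase _ _ h2, hle _ hi' (by simp), hup]
      omega
    · exact (hle S h1 h2).trans_le (sum_le_sum_plus μ q S hS)

theorem upd₂_comm (μ : Fin (n + 1) → ℕ) {i p : Fin (n + 1)} (hip : i ≠ p) (x y : ℕ) :
    upd₂ μ i p x y = upd₂ μ p i y x := by
  funext k
  simp only [upd₂]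
  split_ifs with h1 h2
  · exact absurd (h1.symm.trans h2) hip
  all_goals rfl

/-- Exchanging a smaller entry with a later larger one increases the composition. -/
theorem domLt_act_swap {η : Fin (n + 1) → ℕ} {i p : Fin (n + 1)} (hip : i < p) (h : η p < η i) :
    DomLt (act (Equiv.swap i p) η) η := by
  have hact : ∀ k, act (Equiv.swap i p) η k = η (Equiv.swap i p k) := fun k => by
    rw [act, Equiv.swap_inv]
  refine ⟨fun he => ?_, ?_, fun q => ?_⟩
  · have := congrFun he i
    rw [hact, Equiv.swap_apply_left] at this
    omega
  · simp only [hact]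
    exact Equiv.sum_comp _ _
  · simp only [hact]
    by_cases hq : i ≤ q ∧ q < p
    · refine Finset.sum_le_sum fun k hk => ?_
      have hkp : k ≠ p := ((Finset.mem_Iic.1 hk).trans_lt hq.2).ne
      by_cases hki : k = i
      · rw [hki, Equiv.swap_apply_left]
        exact h.le
      · rw [Equiv.swap_apply_of_ne_of_ne hki hkp]
    · refine le_of_eq (Finset.sum_bij (fun k _ => Equiv.swap i p k) ?_
        (fun a _ b _ h => (Equiv.swap i p).injective h) ?_ (fun _ _ => rfl))
      · intro k hk
        rw [Finset.mem_Iic] at *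
        rcases eq_or_ne k i with rfl | h1
        · rw [Equiv.swap_apply_left]
          by_contra hc
          exact hq ⟨hk, not_le.1 hc⟩
        rcases eq_or_ne k p with rfl | h2
        · rw [Equiv.swap_apply_right]
          exact hip.le.trans hk
        rwa [Equiv.swap_apply_of_ne_of_ne h1 h2]
      · intro k hk
        refine ⟨Equiv.swap i p k, ?_, Equiv.swap_apply_self _ _ _⟩
        rw [Finset.mem_Iic] at *
        rcases eq_or_ne k i with rfl | h1
        · rw [Equiv.swap_apply_left]
          by_contra hc
          exact hq ⟨hk, not_le.1 hc⟩
        rcases eq_or_ne k p with rfl | h2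
        · rw [Equiv.swap_apply_right]
          exact hip.le.trans hk
        rwa [Equiv.swap_apply_of_ne_of_ne h1 h2]

theorem prec_act_swap {η : Fin (n + 1) → ℕ} {i p : Fin (n + 1)} (hip : i < p) (h : η p < η i) :
    Prec (act (Equiv.swap i p) η) η :=
  Or.inr ⟨plus_act _ _, domLt_act_swap hip h⟩

end Order

/-! ### Triangularity of the Cherednik operators on monomials. -/

section Triangularity

variable {n : ℕ} {K : Type*} [Field K]

variable (K) in
/-- The monomial `z^η`. -/
noncomputable def mon (η : Fin (n + 1) → ℕ) : MvPolynomial (Fin (n + 1)) K :=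
  monomial (Finsupp.equivFunOnFinite.symm η) 1

theorem coeff_mon (η : Fin (n + 1) → ℕ) (m : Fin (n + 1) →₀ ℕ) :
    coeff m (mon K η) = if (m : Fin (n + 1) → ℕ) = η then 1 else 0 := by
  rw [mon, coeff_monomial]
  have h : Finsupp.equivFunOnFinite.symm η = m ↔ (m : Fin (n + 1) → ℕ) = η := by
    rw [Equiv.symm_apply_eq, eq_comm]
    rfl
  simp only [h]

theorem rename_mon (w : Equiv.Perm (Fin (n + 1))) (η : Fin (n + 1) → ℕ) :
    rename w (mon K η) = mon K (act w η) := by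
  rw [mon, rename_monomial, mon]
  refine congrArg (fun s => monomial s (1 : K)) ?_
  ext i
  rw [Finsupp.mapDomain_equiv_apply]
  rfl

theorem X_mul_mon (i : Fin (n + 1)) (η ν : Fin (n + 1) → ℕ)
    (h : ∀ k, ν k = η k + if k = i then 1 else 0) :
    (X i * mon K η : MvPolynomial (Fin (n + 1)) K) = mon K ν := by
  rw [mon, X, monomial_mul, one_mul, mon]
  refine congrArg (fun s => monomial s (1 : K)) ?_
  ext k
  simp only [Finsupp.add_apply, Finsupp.equivFunOnFinite_symm_apply_apply, h k,
    Finsupp.single_apply, eq_comm (a := i)]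
  omega

theorem X_mul_mon_upd₂_left (μ : Fin (n + 1) → ℕ) (i p : Fin (n + 1)) (x y : ℕ) :
    (X i * mon K (upd₂ μ i p x y) : MvPolynomial (Fin (n + 1)) K)
      = mon K (upd₂ μ i p (x + 1) y) := by
  refine X_mul_mon _ _ _ fun k => ?_
  simp only [upd₂]
  split_ifs <;> rfl

theorem X_mul_mon_upd₂_right (μ : Fin (n + 1) → ℕ) (i p : Fin (n + 1)) (x y : ℕ) (hip : i ≠ p) :
    (X p * mon K (upd₂ μ i p x y) : MvPolynomial (Fin (n + 1)) K)
      = mon K (upd₂ μ i p x (y + 1)) := by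
  rw [upd₂_comm μ hip, X_mul_mon_upd₂_left, upd₂_comm μ hip.symm]

theorem act_swap_upd₂ (μ : Fin (n + 1) → ℕ) {i p : Fin (n + 1)} (hip : i ≠ p) (x y : ℕ) :
    act (Equiv.swap i p) (upd₂ μ i p x y) = upd₂ μ i p y x := by
  funext k
  simp only [act, Equiv.swap_inv, upd₂, Equiv.swap_apply_def]
  split_ifs <;> simp_all

/-- The geometric sum for `(z_i^k - z_p^k)/(z_i - z_p)`, by telescoping. -/
theorem sub_mul_sum_mon (μ : Fin (n + 1) → ℕ) {i p : Fin (n + 1)} (hip : i ≠ p) (b k : ℕ) :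
    (X i - X p) * ∑ t ∈ Finset.range k, mon K (upd₂ μ i p (b + (k - 1 - t)) (b + t))
      = mon K (upd₂ μ i p (b + k) b) - mon K (upd₂ μ i p b (b + k)) := by
  have h := Finset.sum_range_sub' (fun t => mon K (upd₂ μ i p (b + (k - t)) (b + t))) k
  simp only [Nat.sub_zero, Nat.add_zero, Nat.sub_self] at h
  rw [← h, Finset.mul_sum]
  refine Finset.sum_congr rfl fun t ht => ?_
  have ht := Finset.mem_range.1 ht
  rw [sub_mul, X_mul_mon_upd₂_left, X_mul_mon_upd₂_right _ _ _ _ _ hip]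
  have h1 : b + (k - 1 - t) + 1 = b + (k - t) := by omega
  have h2 : b + (k - 1 - t) = b + (k - (t + 1)) := by omega
  rw [h1, h2, add_assoc b t 1]

theorem divDiff_mon_gt (μ : Fin (n + 1) → ℕ) {i p : Fin (n + 1)} (hip : i ≠ p) (b k : ℕ) :
    divDiff i p (mon K (upd₂ μ i p (b + k) b))
      = ∑ t ∈ Finset.range k, mon K (upd₂ μ i p (b + (k - 1 - t)) (b + t)) :=
  divDiff_eq_of_mul_eq hip (by rw [sub_mul_sum_mon μ hip, rename_mon, act_swap_upd₂ μ hip])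

theorem divDiff_mon_lt (μ : Fin (n + 1) → ℕ) {i p : Fin (n + 1)} (hip : i ≠ p) (b k : ℕ) :
    divDiff i p (mon K (upd₂ μ i p b (b + k)))
      = - ∑ t ∈ Finset.range k, mon K (upd₂ μ i p (b + (k - 1 - t)) (b + t)) :=
  divDiff_eq_of_mul_eq hip (by
    rw [mul_neg, sub_mul_sum_mon μ hip, rename_mon, act_swap_upd₂ μ hip, neg_sub])

variable (K) in
/-- The polynomials all of whose exponents are strictly below `η`. -/
noncomputable def lower (η : Fin (n + 1) → ℕ) : Submodule K (MvPolynomial (Fin (n + 1)) K) :=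
  restrictSupport K {m : Fin (n + 1) →₀ ℕ | Prec (m : Fin (n + 1) → ℕ) η}

theorem mem_lower {η : Fin (n + 1) → ℕ} {f : MvPolynomial (Fin (n + 1)) K} :
    f ∈ lower K η ↔ ∀ m ∈ f.support, Prec (m : Fin (n + 1) → ℕ) η :=
  mem_restrictSupport_iff K

theorem mon_mem_lower {η ν : Fin (n + 1) → ℕ} (h : Prec ν η) : mon K ν ∈ lower K η := by
  rw [mem_lower]
  intro m hm
  rw [mem_support_iff, coeff_mon] at hm
  split_ifs at hm with h1
  · rwa [h1]
  · exact absurd rfl hm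

theorem X_mul_sum_mon (μ : Fin (n + 1) → ℕ) (i p : Fin (n + 1)) (b k : ℕ) :
    X i * ∑ t ∈ Finset.range (k + 1), mon K (upd₂ μ i p (b + (k + 1 - 1 - t)) (b + t))
      = mon K (upd₂ μ i p (b + (k + 1)) b)
        + ∑ t ∈ Finset.range k, mon K (upd₂ μ i p (b + (k - t)) (b + (t + 1))) := by
  rw [Finset.mul_sum, Finset.sum_range_succ', add_comm (Finset.sum _ _)]
  congr 1
  · rw [X_mul_mon_upd₂_left]
    rfl
  · refine Finset.sum_congr rfl fun t ht => ?_
    have ht := Finset.mem_range.1 ht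
    rw [X_mul_mon_upd₂_left]
    have h1 : b + (k + 1 - 1 - (t + 1)) + 1 = b + (k - t) := by omega
    rw [h1]

/-- After multiplication by `z_i` one end of the geometric sum is the monomial with the larger
exponent at `i`. In the remaining terms both exponents lie strictly between the original ones, so
their partitions are strictly dominated. -/
theorem X_mul_divDiff_mon (μ : Fin (n + 1) → ℕ) {i p : Fin (n + 1)} (hip : i ≠ p) :
    X i * divDiff i p (mon K μ) - ((if μ p < μ i then mon K μ else 0)
      - (if μ i < μ p then mon K (act (Equiv.swap i p) μ) else 0)) ∈ lower K μ := by
  rcases lt_trichotomy (μ p) (μ i) with h | h | h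
  · obtain ⟨k, hk⟩ := Nat.exists_eq_add_of_lt h
    have hμ : μ = upd₂ μ i p (μ p + (k + 1)) (μ p) := by
      conv_lhs => rw [← upd₂_self μ i p, hk, add_assoc]
    rw [if_pos h, if_neg h.not_gt]
    conv =>
      enter [2, 1]
      rw [hμ, divDiff_mon_gt _ hip, X_mul_sum_mon]
    rw [← hμ, sub_zero, add_sub_cancel_left]
    refine Submodule.sum_mem _ fun t ht => mon_mem_lower (Or.inl ?_)
    have ht := Finset.mem_range.1 ht
    exact domLt_plus_upd₂ hip (by omega) (by omega) (by omega)
  · have : divDiff i p (mon K μ) = 0 := divDiff_eq_of_mul_eq hip (by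
      have hs : act (Equiv.swap i p) μ = μ := by
        conv_lhs => rw [← upd₂_self μ i p, act_swap_upd₂ μ hip, h]
        conv_rhs => rw [← upd₂_self μ i p, h]
      rw [rename_mon, hs, mul_zero, sub_self])
    rw [this, if_neg h.not_lt, if_neg h.not_gt]
    simp
  · obtain ⟨k, hk⟩ := Nat.exists_eq_add_of_lt h
    have hμ : μ = upd₂ μ i p (μ i) (μ i + (k + 1)) := by
      conv_lhs => rw [← upd₂_self μ i p, hk, add_assoc]
    have hμ' : act (Equiv.swap i p) μ = upd₂ μ i p (μ i + (k + 1)) (μ i) := by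
      conv_lhs => rw [hμ, act_swap_upd₂ _ hip]
    rw [if_pos h, if_neg h.not_gt, hμ']
    conv =>
      enter [2, 1]
      rw [hμ, divDiff_mon_lt _ hip, mul_neg, X_mul_sum_mon]
    rw [zero_sub, sub_neg_eq_add, neg_add_rev, neg_add_cancel_right]
    refine Submodule.neg_mem _ (Submodule.sum_mem _ fun t ht => mon_mem_lower (Or.inl ?_))
    have ht := Finset.mem_range.1 ht
    rw [upd₂_comm μ hip]
    exact domLt_plus_upd₂ hip.symm (by omega) (by omega) (by omega)

theorem X_mul_pderiv_mon (i : Fin (n + 1)) (μ : Fin (n + 1) → ℕ) :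
    X i * pderiv i (mon K μ) = C (μ i : K) * mon K μ := by
  rw [mon, pderiv_monomial, X, monomial_mul, C_mul_monomial]
  by_cases h : μ i = 0
  · simp [h]
  · have hs : Finsupp.single i 1
        + (Finsupp.equivFunOnFinite.symm μ - Finsupp.single i 1 : Fin (n + 1) →₀ ℕ)
        = Finsupp.equivFunOnFinite.symm μ :=
      add_tsub_cancel_of_le (Finsupp.single_le_iff.2 (Nat.one_le_iff_ne_zero.2 h))
    rw [hs]
    simp

/-- The Cherednik operators are triangular in the basis of monomials. -/
theorem cherednik_mon (α : K) (i : Fin (n + 1)) (μ : Fin (n + 1) → ℕ) :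
    cherednik α i (mon K μ) - C (eig α μ i) * mon K μ ∈ lower K μ := by
  -- The constant `-n` is distributed as one `-1` to each `p ≠ i`. Modulo lower terms, `p` then
  -- contributes `-1` if it is counted by the rank of `i`, and `0` otherwise.
  have hterm : ∀ p ∈ Finset.univ.erase i,
      (X i * divDiff i p (mon K μ) + (if i < p then rename (Equiv.swap i p) (mon K μ) else 0)
        - mon K μ) - (-(if μ i < μ p ∨ (μ p = μ i ∧ p < i) then mon K μ else 0)) ∈ lower K μ := by
    intro p hp
    have hip : i ≠ p := (Finset.ne_of_mem_erase hp).symm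
    have h := X_mul_divDiff_mon (K := K) μ hip
    rw [rename_mon]
    set D := X i * divDiff i p (mon K μ)
    rcases lt_trichotomy (μ p) (μ i) with hm | hm | hm
    · have hc : ¬(μ i < μ p ∨ (μ p = μ i ∧ p < i)) := by omega
      rw [if_pos hm, if_neg hm.not_gt] at h
      rw [if_neg hc]
      by_cases hl : i < p
      · rw [if_pos hl]
        have := Submodule.add_mem _ h (mon_mem_lower (K := K) (prec_act_swap hl hm))
        convert this using 1
        ring
      · rw [if_neg hl]
        convert h using 1
        ring
    · rw [if_neg hm.not_lt, if_neg hm.not_gt] at h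
      have hs : act (Equiv.swap i p) μ = μ := by
        conv_lhs => rw [← upd₂_self μ i p, act_swap_upd₂ μ hip, hm]
        conv_rhs => rw [← upd₂_self μ i p, hm]
      rw [hs]
      by_cases hl : i < p
      · rw [if_pos hl, if_neg (by simp only [hl.not_gt, and_false, or_false]; omega)]
        convert h using 1
        ring
      · have hl' : p < i := lt_of_le_of_ne (not_lt.1 hl) hip.symm
        rw [if_neg hl, if_pos (Or.inr ⟨hm, hl'⟩)]
        convert h using 1
        ring
    · rw [if_neg hm.not_gt, if_pos hm] at h
      rw [if_pos (Or.inl hm)]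
      by_cases hl : i < p
      · rw [if_pos hl]
        convert h using 1
        ring
      · have hl' : p < i := lt_of_le_of_ne (not_lt.1 hl) hip.symm
        rw [if_neg hl]
        rw [Equiv.swap_comm] at h
        have := Submodule.sub_mem _ h (mon_mem_lower (K := K) (prec_act_swap hl' hm))
        convert this using 1
        ring
  have hsum := Submodule.sum_mem _ hterm
  have hioi : ∑ p ∈ Finset.Ioi i, rename (Equiv.swap i p) (mon K μ)
      = ∑ p ∈ Finset.univ.erase i, if i < p then rename (Equiv.swap i p) (mon K μ) else 0 := by
    rw [← Finset.sum_filter]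
    refine Finset.sum_congr ?_ fun _ _ => rfl
    ext p
    simp only [Finset.mem_Ioi, Finset.mem_filter, Finset.mem_erase, Finset.mem_univ, and_true]
    exact ⟨fun h => ⟨h.ne', h⟩, fun h => h.2⟩
  have hcard : C (n : K) * mon K μ = ∑ _p ∈ Finset.univ.erase i, mon K μ := by
    simp
  have hrk : C (rk μ i : K) * mon K μ = ∑ p ∈ Finset.univ.erase i,
      if μ i < μ p ∨ (μ p = μ i ∧ p < i) then mon K μ else 0 := by
    rw [← Finset.sum_filter, Finset.sum_const, nsmul_eq_mul, map_natCast, rk]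
    congr 3
    ext p
    simp only [Finset.mem_filter, Finset.mem_erase, Finset.mem_univ, and_true, true_and]
    refine ⟨fun h => ⟨?_, h⟩, fun h => h.2⟩
    rintro rfl
    simp at h
  convert hsum using 1
  rw [Finset.sum_sub_distrib, Finset.sum_sub_distrib, Finset.sum_add_distrib, ← hioi, ← hcard,
    Finset.sum_neg_distrib, ← hrk, cherednik_eq_dunkl, dunkl, eig_eq_rk, mul_assoc (C α),
    X_mul_pderiv_mon, C_sub, C_mul]
  ring

theorem eq_sum_mon (f : MvPolynomial (Fin (n + 1)) K) :
    f = ∑ m ∈ f.support, C (coeff m f) * mon K (m : Fin (n + 1) → ℕ) := by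
  conv_lhs => rw [f.as_sum]
  refine Finset.sum_congr rfl fun m _ => ?_
  rw [mon, C_mul_monomial, mul_one]
  exact congrArg (fun s => monomial s (coeff m f)) (Finsupp.equivFunOnFinite.symm_apply_apply m).symm

/-- By triangularity another monomial of `f` could contribute to `z^m` only if its exponent were
strictly above `m`. -/
theorem coeff_cherednik_of_maximal (α : K) (i : Fin (n + 1)) (f : MvPolynomial (Fin (n + 1)) K)
    (m : Fin (n + 1) →₀ ℕ)
    (hm : ∀ m' ∈ f.support, ¬Prec (m : Fin (n + 1) → ℕ) (m' : Fin (n + 1) → ℕ)) :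
    coeff m (cherednik α i f) = eig α m i * coeff m f := by
  have h : cherednik α i f = ∑ m' ∈ f.support, C (coeff m' f) * cherednik α i (mon K m') := by
    conv_lhs => rw [eq_sum_mon f]
    change cherednikₗ α i _ = _
    rw [map_sum]
    exact Finset.sum_congr rfl fun m' _ => cherednik_C_mul _ _ _ _
  have h1 : ∀ m' ∈ f.support, coeff m (C (coeff m' f) * cherednik α i (mon K m'))
      = eig α m i * coeff m (C (coeff m' f) * mon K m') := by
    intro m' hm'
    have h2 := mem_lower.1 (cherednik_mon α i (m' : Fin (n + 1) → ℕ)) m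
    have h3 : coeff m (cherednik α i (mon K m') - C (eig α m' i) * mon K m') = 0 := by
      by_contra hc
      exact hm m' hm' (h2 (mem_support_iff.2 hc))
    rw [coeff_sub, coeff_C_mul, sub_eq_zero] at h3
    rw [coeff_C_mul, h3, coeff_C_mul, coeff_mon]
    split_ifs with he
    · rw [he]; ring
    · ring
  conv_rhs => rw [eq_sum_mon f]
  rw [h, coeff_sum, coeff_sum, Finset.mul_sum]
  exact Finset.sum_congr rfl h1

/-- Every exponent of a joint eigenfunction lies below one that accounts for the eigenvalues. -/
theorem exists_eig_eq_of_eigen {α : K} {f : MvPolynomial (Fin (n + 1)) K} {e : Fin (n + 1) → K}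
    (hf : ∀ i, cherednik α i f = C (e i) * f) {m : Fin (n + 1) →₀ ℕ} (hm : m ∈ f.support) :
    ∃ m' ∈ f.support, (∀ i, eig α (m' : Fin (n + 1) → ℕ) i = e i) ∧
      ((m : Fin (n + 1) → ℕ) = m' ∨ Prec (m : Fin (n + 1) → ℕ) m') := by
  classical
  obtain ⟨ν, hν, hle, hmax⟩ := exists_maximal_prec
    (Finset.image (fun m : Fin (n + 1) →₀ ℕ => (m : Fin (n + 1) → ℕ)) f.support)
    (Finset.mem_image_of_mem _ hm)
  obtain ⟨m', hm', rfl⟩ := Finset.mem_image.1 hν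
  refine ⟨m', hm', fun i => ?_, hle⟩
  have h1 := coeff_cherednik_of_maximal α i f m' fun m'' h =>
    hmax _ (Finset.mem_image_of_mem _ h)
  rw [hf, coeff_C_mul] at h1
  exact (mul_right_cancel₀ (mem_support_iff.1 hm') h1).symm

theorem prec_of_mem_support_of_eigen [CharZero K] {α : K}
    (hα : ∀ a b : ℕ, 0 < a → (a : K) * α + (b : K) ≠ 0) {η : Fin (n + 1) → ℕ}
    {f : MvPolynomial (Fin (n + 1)) K} (hf : ∀ i, cherednik α i f = C (eig α η i) * f)
    {m : Fin (n + 1) →₀ ℕ} (hm : m ∈ f.support) :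
    Finsupp.equivFunOnFinite.symm η ∈ f.support ∧
      ((m : Fin (n + 1) → ℕ) = η ∨ Prec (m : Fin (n + 1) → ℕ) η) := by
  obtain ⟨m', hm', he, hle⟩ := exists_eig_eq_of_eigen hf hm
  have he : (m' : Fin (n + 1) → ℕ) = η := eig_injective hα he
  have he' : Finsupp.equivFunOnFinite.symm η = m' := by
    rw [Equiv.symm_apply_eq, ← he]
    rfl
  rw [he']
  exact ⟨hm', he ▸ hle⟩

theorem eq_zero_of_eigen [CharZero K] {α : K}
    (hα : ∀ a b : ℕ, 0 < a → (a : K) * α + (b : K) ≠ 0) {η : Fin (n + 1) → ℕ}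
    {f : MvPolynomial (Fin (n + 1)) K} (hf : ∀ i, cherednik α i f = C (eig α η i) * f)
    (h0 : coeff (Finsupp.equivFunOnFinite.symm η) f = 0) : f = 0 := by
  by_contra hne
  obtain ⟨m, hm⟩ := Finset.nonempty_of_ne_empty fun h => hne (support_eq_empty.1 h)
  exact mem_support_iff.1 (prec_of_mem_support_of_eigen hα hf hm).1 h0

end Triangularity

/-! ### Nonsymmetric Jack polynomials and the action of simple transpositions on them. -/

section Nonsymmetric

variable {n : ℕ} {K : Type*} [Field K]

theorem act_simple_induction {P : (Fin (n + 1) → ℕ) → Prop}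
    (h : ∀ k η, P η → P (act (simple k) η)) (w : Equiv.Perm (Fin (n + 1)))
    {η : Fin (n + 1) → ℕ} (hη : P η) : P (act w η) := by
  have hw : w ∈ Submonoid.closure
      (Set.range fun i : Fin n => Equiv.swap i.castSucc i.succ) := by
    rw [Equiv.Perm.mclosure_swap_castSucc_succ]
    trivial
  induction hw using Submonoid.closure_induction_left with
  | one => rwa [act_one]
  | mul_left x hx y hy ih =>
    obtain ⟨k, rfl⟩ := hx
    rw [act_mul]
    exact h k _ ih

theorem exists_eigen_raiseComp {α : K} {η : Fin (n + 1) → ℕ}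
    (h : ∃ f : MvPolynomial (Fin (n + 1)) K, f ≠ 0 ∧
      ∀ i, cherednik α i f = C (eig α η i) * f) :
    ∃ f : MvPolynomial (Fin (n + 1)) K, f ≠ 0 ∧
      ∀ i, cherednik α i f = C (eig α (raiseComp η) i) * f := by
  obtain ⟨f, hf, he⟩ := h
  refine ⟨raise f, raise_ne_zero hf, fun i => ?_⟩
  induction i using Fin.lastCases with
  | last =>
    rw [cherednik_last_raise, he, eig_raiseComp_last, raise, raise, C_add]
    simp only [map_add, map_mul, rename_C]
    ring
  | cast j =>
    rw [cherednik_castSucc_raise, he, eig_raiseComp_castSucc, raise, raise, map_mul, rename_C]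
    ring

theorem exists_eigen_act_simple {α : K}
    (hα : ∀ a b : ℕ, 0 < a → (a : K) * α + (b : K) ≠ 0) (k : Fin n) {η : Fin (n + 1) → ℕ}
    (h : ∃ f : MvPolynomial (Fin (n + 1)) K, f ≠ 0 ∧
      ∀ i, cherednik α i f = C (eig α η i) * f) :
    ∃ f : MvPolynomial (Fin (n + 1)) K, f ≠ 0 ∧
      ∀ i, cherednik α i f = C (eig α (act (simple k) η) i) * f := by
  by_cases hk : η k.castSucc = η k.succ
  · rwa [act_simple_of_eq hk]
  obtain ⟨f, hf, he⟩ := h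
  have hδ := eig_sub_ne_zero hα (k := k) η
  refine ⟨rename (simple k) f - C (eig α η k.castSucc - eig α η k.succ)⁻¹ * f,
    fun h0 => ?_, fun i => ?_⟩
  rotate_left
  · rw [eig_act_simple α hk]
    exact cherednik_intertwine α k f _ he hδ i
  -- If the intertwined function vanished, then `s_k f = δ⁻¹ f`; applying `s_k` again would give `δ²
  -- = 1`, which is excluded.
  obtain ⟨h1, h2⟩ := eig_sub_ne_of_ne hα hk
  set δ := eig α η k.castSucc - eig α η k.succ
  have h3 := sub_eq_zero.1 h0
  have h4 := congrArg (rename (simple k)) h3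
  rw [rename_simple_rename_simple, map_mul, rename_C, h3, ← mul_assoc, ← C_mul] at h4
  have h5 : C (1 - δ⁻¹ * δ⁻¹) * f = 0 := by
    rw [C_sub, C_1, sub_mul, one_mul, ← h4, sub_self]
  rcases mul_eq_zero.1 h5 with h6 | h6
  · have h7 : 1 - δ⁻¹ * δ⁻¹ = 0 := C_injective _ _ (h6.trans C_0.symm)
    field_simp at h7
    refine mul_ne_zero h1 h2 ?_
    linear_combination h7
  · exact hf h6

theorem exists_eigen {α : K} (hα : ∀ a b : ℕ, 0 < a → (a : K) * α + (b : K) ≠ 0)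
    (η : Fin (n + 1) → ℕ) : ∃ f : MvPolynomial (Fin (n + 1)) K, f ≠ 0 ∧
      ∀ i, cherednik α i f = C (eig α η i) * f := by
  induction hs : ∑ i, η i generalizing η with
  | zero =>
    have h0 : ∀ i, η i = 0 := fun i => (Finset.sum_eq_zero_iff.1 hs) i (Finset.mem_univ i)
    refine ⟨1, one_ne_zero, fun i => ?_⟩
    rw [cherednik_one, mul_one, eig]
    simp [h0]
  | succ d ih =>
    obtain ⟨j, hj⟩ : ∃ j, 0 < η j := by
      by_contra! hc
      rw [Finset.sum_eq_zero fun i _ => Nat.le_zero.1 (hc i)] at hs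
      omega
    -- A positive entry is moved to the end, so that the composition is raised from one of smaller
    -- degree; intertwiners then move the entry back.
    have h1 : 0 < act (Equiv.swap j (Fin.last n)) η (Fin.last n) := by
      rwa [act, Equiv.swap_inv, Equiv.swap_apply_right]
    obtain ⟨ν, hν, hsum⟩ := exists_eq_raiseComp h1
    have h2 : ∑ i, act (Equiv.swap j (Fin.last n)) η i = d + 1 := by
      rw [← hs]
      exact Equiv.sum_comp (Equiv.swap j (Fin.last n))⁻¹ η
    have h3 := exists_eigen_raiseComp (ih ν (by omega))
    rw [← hν] at h3
    have h4 := act_simple_induction (P := fun η => ∃ f : MvPolynomial (Fin (n + 1)) K, f ≠ 0 ∧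
      ∀ i, cherednik α i f = C (eig α η i) * f) (fun k η h => exists_eigen_act_simple hα k h)
      (Equiv.swap j (Fin.last n)) h3
    rwa [← act_mul, Equiv.swap_mul_self, act_one] at h4

theorem existsUnique_isNonsymJack [CharZero K] {α : K}
    (hα : ∀ a b : ℕ, 0 < a → (a : K) * α + (b : K) ≠ 0) (η : Fin (n + 1) → ℕ) :
    ∃! E : MvPolynomial (Fin (n + 1)) K, IsNonsymJack α η E := by
  obtain ⟨f, hf, he⟩ := exists_eigen hα η
  have hc : coeff (Finsupp.equivFunOnFinite.symm η) f ≠ 0 := fun h =>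
    hf (eq_zero_of_eigen hα he h)
  set c := coeff (Finsupp.equivFunOnFinite.symm η) f
  have he' : ∀ i, cherednik α i (C c⁻¹ * f) = C (eig α η i) * (C c⁻¹ * f) := fun i => by
    rw [cherednik_C_mul, he]
    ring
  refine ⟨C c⁻¹ * f, ⟨he', ?_, fun m hm hne =>
    (prec_of_mem_support_of_eigen hα he' hm).2.resolve_left hne⟩, fun g hg => ?_⟩
  · rw [coeff_C_mul, inv_mul_cancel₀ hc]
  · rw [← sub_eq_zero]
    refine eq_zero_of_eigen hα (η := η) (fun i => ?_) ?_
    · rw [cherednik_sub, he', hg.1, mul_sub]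
    · rw [coeff_sub, hg.2.1, coeff_C_mul, inv_mul_cancel₀ hc, sub_self]

theorem isNonsymJack_nonsymJack [CharZero K] {α : K}
    (hα : ∀ a b : ℕ, 0 < a → (a : K) * α + (b : K) ≠ 0) (η : Fin (n + 1) → ℕ) :
    IsNonsymJack α η (nonsymJack α η) :=
  Classical.epsilon_spec (existsUnique_isNonsymJack hα η).exists

theorem coeff_nonsymJack_self [CharZero K] {α : K}
    (hα : ∀ a b : ℕ, 0 < a → (a : K) * α + (b : K) ≠ 0) (η : Fin (n + 1) → ℕ) :
    coeff (Finsupp.equivFunOnFinite.symm η) (nonsymJack α η) = 1 :=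
  (isNonsymJack_nonsymJack hα η).2.1

theorem coeff_nonsymJack_eq_zero [CharZero K] {α : K}
    (hα : ∀ a b : ℕ, 0 < a → (a : K) * α + (b : K) ≠ 0) {η ν : Fin (n + 1) → ℕ}
    (hne : ν ≠ η) (h : ¬Prec ν η) :
    coeff (Finsupp.equivFunOnFinite.symm ν) (nonsymJack α η) = 0 := by
  by_contra hc
  exact h ((isNonsymJack_nonsymJack hα η).2.2 _ (mem_support_iff.2 hc) hne)

theorem eq_C_mul_nonsymJack [CharZero K] {α : K}
    (hα : ∀ a b : ℕ, 0 < a → (a : K) * α + (b : K) ≠ 0) {η : Fin (n + 1) → ℕ}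
    {f : MvPolynomial (Fin (n + 1)) K} (hf : ∀ i, cherednik α i f = C (eig α η i) * f) :
    f = C (coeff (Finsupp.equivFunOnFinite.symm η) f) * nonsymJack α η := by
  rw [← sub_eq_zero]
  refine eq_zero_of_eigen hα (η := η) (fun i => ?_) ?_
  · rw [cherednik_sub, cherednik_C_mul, hf, (isNonsymJack_nonsymJack hα η).1]
    ring
  · rw [coeff_sub, coeff_C_mul, coeff_nonsymJack_self hα, mul_one, sub_self]

theorem coeff_rename_act (w : Equiv.Perm (Fin (n + 1))) (η : Fin (n + 1) → ℕ)
    (f : MvPolynomial (Fin (n + 1)) K) :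
    coeff (Finsupp.equivFunOnFinite.symm (act w η)) (rename w f)
      = coeff (Finsupp.equivFunOnFinite.symm η) f := by
  have : Finsupp.equivFunOnFinite.symm (act w η)
      = Finsupp.mapDomain w (Finsupp.equivFunOnFinite.symm η) := by
    ext i
    rw [Finsupp.mapDomain_equiv_apply]
    rfl
  rw [this, coeff_rename_mapDomain _ w.injective]

/-- The difference of the eigenvalues at positions `k` and `k + 1`. -/
noncomputable def gap (α : K) (k : Fin n) (μ : Fin (n + 1) → ℕ) : K :=
  eig α μ k.castSucc - eig α μ k.succ

theorem gap_act_simple (α : K) {k : Fin n} {μ : Fin (n + 1) → ℕ} (h : μ k.castSucc ≠ μ k.succ) :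
    gap α k (act (simple k) μ) = - gap α k μ := by
  rw [gap, gap, eig_act_simple α h, eig_act_simple α h, simple_castSucc, simple_succ, neg_sub]

/-- The intertwined function is a multiple of `E_{s_k μ}`. Since `μ ≺ s_k μ`, the monomial `z^{s_k
μ}` is absent from `E_μ` and has coefficient 1 in `s_k E_μ`, so the multiple is 1. -/
theorem rename_simple_nonsymJack_of_lt [CharZero K] {α : K}
    (hα : ∀ a b : ℕ, 0 < a → (a : K) * α + (b : K) ≠ 0) {k : Fin n} {μ : Fin (n + 1) → ℕ}
    (h : μ k.castSucc < μ k.succ) :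
    rename (simple k) (nonsymJack α μ)
      = C (gap α k μ)⁻¹ * nonsymJack α μ + nonsymJack α (act (simple k) μ) := by
  have he := cherednik_intertwine α k (nonsymJack α μ) _ (isNonsymJack_nonsymJack hα μ).1
    (eig_sub_ne_zero hα μ)
  simp only [← eig_act_simple α h.ne] at he
  have h1 := eq_C_mul_nonsymJack hα he
  have hp : Prec μ (act (simple k) μ) := by
    have : act (simple k) μ k.succ < act (simple k) μ k.castSucc := by
      rwa [act_simple_castSucc, act_simple_succ]
    have := prec_act_swap Fin.castSucc_lt_succ this
    rwa [← simple, act_simple_simple] at this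
  rw [coeff_sub, coeff_rename_act, coeff_nonsymJack_self hα, coeff_C_mul,
    coeff_nonsymJack_eq_zero hα hp.ne.symm fun hc => Prec.irrefl _ (hp.trans hc), mul_zero,
    sub_zero, C_1, one_mul] at h1
  rw [← h1, gap]
  ring

/-- Here `δ = 1`, and `s_k E_μ - E_μ` would be an eigenfunction with two eigenvalues of `μ`
exchanged. If nonzero, it would have an exponent accounting for them, necessarily `μ` by
`eq_of_eig_eq_comp`; the two eigenvalues would then coincide, against `δ = 1`. -/
theorem rename_simple_nonsymJack_of_eq [CharZero K] {α : K}
    (hα : ∀ a b : ℕ, 0 < a → (a : K) * α + (b : K) ≠ 0) {k : Fin n} {μ : Fin (n + 1) → ℕ}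
    (h : μ k.castSucc = μ k.succ) : rename (simple k) (nonsymJack α μ) = nonsymJack α μ := by
  have he := cherednik_intertwine α k (nonsymJack α μ) _ (isNonsymJack_nonsymJack hα μ).1
    (eig_sub_ne_zero hα μ)
  have hgap := eig_sub_of_eq α h
  rw [hgap, inv_one, C_1, one_mul] at he
  by_contra hne
  obtain ⟨m, hm⟩ := Finset.nonempty_of_ne_empty fun h => hne (sub_eq_zero.1 (support_eq_empty.1 h))
  obtain ⟨m', _, h1, _⟩ := exists_eig_eq_of_eigen he hm
  have h2 : (m' : Fin (n + 1) → ℕ) = μ := by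
    refine eq_of_eig_eq_comp hα (simple k) (fun i => ?_) h1
    conv_rhs => rw [← act_simple_of_eq h, act_simple]
  rw [h2] at h1
  have h3 := h1 k.castSucc
  rw [simple_castSucc] at h3
  rw [h3, sub_self] at hgap
  exact zero_ne_one hgap

/-- Apply `s_k` to the formula for `s_k μ`, whose gap has the opposite sign, and solve for `s_k
E_μ`. -/
theorem rename_simple_nonsymJack_of_gt [CharZero K] {α : K}
    (hα : ∀ a b : ℕ, 0 < a → (a : K) * α + (b : K) ≠ 0) {k : Fin n} {μ : Fin (n + 1) → ℕ}
    (h : μ k.succ < μ k.castSucc) :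
    rename (simple k) (nonsymJack α μ) = C (gap α k μ)⁻¹ * nonsymJack α μ
      + C (1 - (gap α k μ)⁻¹ * (gap α k μ)⁻¹) * nonsymJack α (act (simple k) μ) := by
  have h' : act (simple k) μ k.castSucc < act (simple k) μ k.succ := by
    rwa [act_simple_castSucc, act_simple_succ]
  have h1 := rename_simple_nonsymJack_of_lt hα h'
  rw [act_simple_simple, gap_act_simple α h.ne'] at h1
  have h2 := congrArg (rename (simple k)) h1
  rw [rename_simple_rename_simple, map_add, map_mul, rename_C, h1, inv_neg, C_neg] at h2
  rw [C_sub, C_mul, C_1]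
  linear_combination - h2

/-- The coefficient of `E_{s_k μ}` in `s_k E_μ`. -/
noncomputable def offDiag (α : K) (k : Fin n) (μ : Fin (n + 1) → ℕ) : K :=
  if μ k.castSucc < μ k.succ then 1 else 1 - (gap α k μ)⁻¹ * (gap α k μ)⁻¹

theorem rename_simple_nonsymJack [CharZero K] {α : K}
    (hα : ∀ a b : ℕ, 0 < a → (a : K) * α + (b : K) ≠ 0) (k : Fin n) (μ : Fin (n + 1) → ℕ) :
    rename (simple k) (nonsymJack α μ) = C (gap α k μ)⁻¹ * nonsymJack α μ
      + C (offDiag α k μ) * nonsymJack α (act (simple k) μ) := by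
  rcases lt_trichotomy (μ k.castSucc) (μ k.succ) with h | h | h
  · rw [rename_simple_nonsymJack_of_lt hα h, offDiag, if_pos h, C_1, one_mul]
  · rw [rename_simple_nonsymJack_of_eq hα h, offDiag, if_neg h.not_lt, gap, eig_sub_of_eq α h]
    simp
  · rw [rename_simple_nonsymJack_of_gt hα h, offDiag, if_neg h.not_gt]

/-- At a maximal index with nonzero coefficient, only its own polynomial contains the leading
monomial. -/
theorem sum_C_mul_nonsymJack_eq_zero [CharZero K] {α : K}
    (hα : ∀ a b : ℕ, 0 < a → (a : K) * α + (b : K) ≠ 0) (s : Finset (Fin (n + 1) → ℕ))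
    (g : (Fin (n + 1) → ℕ) → K) (h : ∑ μ ∈ s, C (g μ) * nonsymJack α μ = 0) :
    ∀ μ ∈ s, g μ = 0 := by
  classical
  by_contra! hc
  obtain ⟨μ, hμ, hg⟩ := hc
  obtain ⟨ν, hν, -, hmax⟩ := exists_maximal_prec (s.filter fun μ => g μ ≠ 0)
    (Finset.mem_filter.2 ⟨hμ, hg⟩)
  obtain ⟨hν1, hν2⟩ := Finset.mem_filter.1 hν
  have h1 := congrArg (coeff (Finsupp.equivFunOnFinite.symm ν)) h
  rw [coeff_sum, Finset.sum_eq_single ν, coeff_C_mul, coeff_nonsymJack_self hα, mul_one,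
    coeff_zero] at h1
  · exact hν2 h1
  · intro κ hκ hne
    rw [coeff_C_mul]
    by_cases h0 : g κ = 0
    · rw [h0, zero_mul]
    · rw [coeff_nonsymJack_eq_zero hα hne.symm (hmax κ (Finset.mem_filter.2 ⟨hκ, h0⟩)), mul_zero]
  · exact fun h => absurd hν1 h

theorem eq_of_sum_C_mul_nonsymJack_eq [CharZero K] {α : K}
    (hα : ∀ a b : ℕ, 0 < a → (a : K) * α + (b : K) ≠ 0) (s : Finset (Fin (n + 1) → ℕ))
    {g g' : (Fin (n + 1) → ℕ) → K}
    (h : ∑ μ ∈ s, C (g μ) * nonsymJack α μ = ∑ μ ∈ s, C (g' μ) * nonsymJack α μ) :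
    ∀ μ ∈ s, g μ = g' μ := by
  intro μ hμ
  rw [← sub_eq_zero]
  refine sum_C_mul_nonsymJack_eq_zero hα s (fun μ => g μ - g' μ) ?_ μ hμ
  simp only [C_sub, sub_mul, Finset.sum_sub_distrib, h, sub_self]

/-- The action of `s_k` on an expansion in nonsymmetric Jack polynomials. -/
theorem rename_simple_sum [CharZero K] {α : K}
    (hα : ∀ a b : ℕ, 0 < a → (a : K) * α + (b : K) ≠ 0) (k : Fin n)
    (s : Finset (Fin (n + 1) → ℕ)) (hs : ∀ μ ∈ s, act (simple k) μ ∈ s)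
    (g : (Fin (n + 1) → ℕ) → K) :
    rename (simple k) (∑ μ ∈ s, C (g μ) * nonsymJack α μ)
      = ∑ μ ∈ s, C (g μ * (gap α k μ)⁻¹
        + g (act (simple k) μ) * offDiag α k (act (simple k) μ)) * nonsymJack α μ := by
  have h1 : ∑ μ ∈ s, C (g (act (simple k) μ) * offDiag α k (act (simple k) μ)) * nonsymJack α μ
      = ∑ μ ∈ s, C (g μ * offDiag α k μ) * nonsymJack α (act (simple k) μ) := by
    refine Finset.sum_bij (fun μ _ => act (simple k) μ) hs ?_ ?_ ?_
    · intro a _ b _ h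
      rw [← act_simple_simple k a, h, act_simple_simple]
    · exact fun b hb => ⟨act (simple k) b, hs b hb, act_simple_simple k b⟩
    · intro a _
      rw [act_simple_simple]
  simp only [C_add, add_mul, Finset.sum_add_distrib, h1]
  rw [map_sum, ← Finset.sum_add_distrib]
  refine Finset.sum_congr rfl fun μ _ => ?_
  rw [map_mul, rename_C, rename_simple_nonsymJack hα, C_mul, C_mul]
  ring

end Nonsymmetric

/-! ### Parabolic subgroups, their blocks of positions, and orbits. -/

section Blocks

variable {n : ℕ}

/-- The index of the block of positions connected by the simple transpositions in `A`. -/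
def blk (A : Finset (Fin n)) (a : Fin (n + 1)) : ℕ :=
  (Finset.univ.filter (fun k : Fin n => k ∉ A ∧ k.castSucc < a)).card

theorem blk_mono (A : Finset (Fin n)) : Monotone (blk A) := fun a b h =>
  Finset.card_le_card fun k hk => by
    simp only [Finset.mem_filter, Finset.mem_univ, true_and] at hk ⊢
    exact ⟨hk.1, hk.2.trans_le h⟩

theorem blk_castSucc_eq_succ_iff {A : Finset (Fin n)} {k : Fin n} :
    blk A k.castSucc = blk A k.succ ↔ k ∈ A := by
  constructor
  · intro h
    by_contra hk
    refine (Finset.card_lt_card (s := Finset.univ.filter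
      (fun j : Fin n => j ∉ A ∧ j.castSucc < k.castSucc))
      (t := Finset.univ.filter (fun j : Fin n => j ∉ A ∧ j.castSucc < k.succ))
      ⟨fun j hj => ?_, fun hs => ?_⟩).ne h
    · simp only [Finset.mem_filter, Finset.mem_univ, true_and] at hj ⊢
      exact ⟨hj.1, hj.2.trans Fin.castSucc_lt_succ⟩
    · have := hs (x := k) (by simp [hk])
      simp at this
  · intro hk
    refine congrArg Finset.card (Finset.filter_congr fun j _ => ?_)
    constructor
    · exact fun h => ⟨h.1, h.2.trans Fin.castSucc_lt_succ⟩
    · rintro ⟨h1, h2⟩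
      refine ⟨h1, ?_⟩
      have hjk : j ≠ k := fun h => h1 (h ▸ hk)
      have := Fin.val_ne_of_ne hjk
      simp only [Fin.lt_def, Fin.val_castSucc, Fin.val_succ] at *
      omega

theorem blk_simple {A : Finset (Fin n)} {k : Fin n} (hk : k ∈ A) (a : Fin (n + 1)) :
    blk A (simple k a) = blk A a := by
  have h := blk_castSucc_eq_succ_iff.2 hk
  by_cases h1 : a = k.castSucc
  · rw [h1, simple_castSucc, h]
  by_cases h2 : a = k.succ
  · rw [h2, simple_succ, h]
  rw [simple_of_ne h1 h2]

theorem W_induction {A : Finset (Fin n)} {P : Equiv.Perm (Fin (n + 1)) → Prop} (h1 : P 1)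
    (hmul : ∀ k ∈ A, ∀ w ∈ W A, P w → P (simple k * w)) {w : Equiv.Perm (Fin (n + 1))}
    (hw : w ∈ W A) : P w := by
  induction hw using Subgroup.closure_induction_left with
  | one => exact h1
  | mul_left x hx y hy ih =>
    obtain ⟨k, hk, rfl⟩ := hx
    exact hmul k hk y hy ih
  | inv_mul_cancel x hx y hy ih =>
    obtain ⟨k, hk, rfl⟩ := hx
    rw [simple_inv]
    exact hmul k hk y hy ih

theorem simple_mem_W {A : Finset (Fin n)} {k : Fin n} (hk : k ∈ A) : simple k ∈ W A :=
  Subgroup.subset_closure ⟨k, hk, rfl⟩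

theorem simple_mul_mem_W {A : Finset (Fin n)} {k : Fin n} (hk : k ∈ A)
    {w : Equiv.Perm (Fin (n + 1))} (hw : w ∈ W A) : simple k * w ∈ W A :=
  mul_mem (simple_mem_W hk) hw

theorem W_mono {A B : Finset (Fin n)} (h : A ⊆ B) : W A ≤ W B :=
  Subgroup.closure_mono (Set.image_mono (Finset.coe_subset.2 h))

theorem blk_of_mem_W {A : Finset (Fin n)} {w : Equiv.Perm (Fin (n + 1))} (hw : w ∈ W A) :
    ∀ a, blk A (w a) = blk A a := by
  refine W_induction (P := fun w => ∀ a, blk A (w a) = blk A a) (fun _ => rfl) ?_ hw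
  intro k hk w _ ih a
  rw [Equiv.Perm.mul_apply, blk_simple hk, ih]

theorem exists_castSucc_eq_of_blk_eq {A : Finset (Fin n)} {a b : Fin (n + 1)} (hab : a < b)
    (h : blk A a = blk A b) : ∃ k ∈ A, k.castSucc = a := by
  have ha : (a : ℕ) < n := by
    have := b.2
    rw [Fin.lt_def] at hab
    omega
  refine ⟨⟨a, ha⟩, blk_castSucc_eq_succ_iff.1 (le_antisymm (blk_mono A Fin.castSucc_lt_succ.le) ?_),
    rfl⟩
  exact (blk_mono A (show Fin.succ ⟨a, ha⟩ ≤ b from Fin.le_def.2 hab)).trans h.ge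

theorem exists_succ_eq_of_blk_eq {A : Finset (Fin n)} {a b : Fin (n + 1)} (hab : a < b)
    (h : blk A a = blk A b) : ∃ k ∈ A, k.succ = b ∧ a ≤ k.castSucc := by
  obtain ⟨j, rfl⟩ := Fin.exists_succ_eq.2 (Fin.ne_zero_of_lt hab)
  have haj : a ≤ j.castSucc := by
    rw [Fin.lt_def, Fin.val_succ] at hab
    rw [Fin.le_def, Fin.val_castSucc]
    omega
  refine ⟨j, blk_castSucc_eq_succ_iff.1 (le_antisymm (blk_mono A Fin.castSucc_lt_succ.le) ?_),
    rfl, haj⟩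
  rw [← h]
  exact blk_mono A haj

/-- Two positions in one block are joined by steps `k` to `k + 1` with `k ∈ A`, so transitive
relations propagate from neighbours. -/
theorem rel_of_blk_eq {A : Finset (Fin n)} {R : Fin (n + 1) → Fin (n + 1) → Prop}
    (htrans : ∀ a b c, R a b → R b c → R a c) (hR : ∀ k ∈ A, R k.castSucc k.succ)
    {a b : Fin (n + 1)} (hab : a < b) (h : blk A a = blk A b) : R a b := by
  induction b using Fin.induction with
  | zero => exact absurd hab (Fin.not_lt_zero a)
  | succ j ih =>
    obtain ⟨k, hk, hkj, hak⟩ := exists_succ_eq_of_blk_eq hab h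
    obtain rfl := Fin.succ_injective _ hkj
    rcases hak.eq_or_lt with rfl | hlt
    · exact hR k hk
    · exact htrans _ _ _ (ih hlt (h.trans (blk_castSucc_eq_succ_iff.2 hk).symm)) (hR k hk)

/-- A transposition away from `A` fixes all positions in nontrivial blocks of `A`. -/
theorem simple_apply_of_blk_eq {A : Finset (Fin n)} {i : Fin n} (hi : i ∉ A)
    (hA : ∀ j ∈ A, (i : ℕ) + 1 ≠ j ∧ (j : ℕ) + 1 ≠ i) {a b : Fin (n + 1)} (hab : a ≠ b)
    (h : blk A a = blk A b) : simple i a = a := by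
  refine simple_of_ne ?_ ?_ <;> rintro rfl <;> rcases lt_or_gt_of_ne hab with hlt | hlt
  · obtain ⟨k, hk, hki⟩ := exists_castSucc_eq_of_blk_eq hlt h
    exact hi (Fin.castSucc_injective _ hki ▸ hk)
  · obtain ⟨k, hk, hki, -⟩ := exists_succ_eq_of_blk_eq hlt h.symm
    exact (hA k hk).2 (by simpa using congrArg Fin.val hki)
  · obtain ⟨k, hk, hki⟩ := exists_castSucc_eq_of_blk_eq hlt h
    exact (hA k hk).1 (by simpa using (congrArg Fin.val hki).symm)
  · obtain ⟨k, hk, hki, -⟩ := exists_succ_eq_of_blk_eq hlt h.symm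
    exact hi (Fin.succ_injective _ hki ▸ hk)

theorem mem_orbit {A : Finset (Fin n)} {η μ : Fin (n + 1) → ℕ} :
    μ ∈ orbit A η ↔ ∃ w ∈ W A, act w η = μ := by
  simp [orbit]

theorem self_mem_orbit (A : Finset (Fin n)) (η : Fin (n + 1) → ℕ) : η ∈ orbit A η :=
  mem_orbit.2 ⟨1, one_mem _, act_one η⟩

theorem act_simple_mem_orbit {A : Finset (Fin n)} {η μ : Fin (n + 1) → ℕ} {k : Fin n}
    (hk : k ∈ A) (h : μ ∈ orbit A η) : act (simple k) μ ∈ orbit A η := by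
  obtain ⟨w, hw, rfl⟩ := mem_orbit.1 h
  exact mem_orbit.2 ⟨simple k * w, simple_mul_mem_W hk hw, act_mul _ _ _⟩

theorem orbit_induction {A : Finset (Fin n)} {η : Fin (n + 1) → ℕ}
    {P : (Fin (n + 1) → ℕ) → Prop} (h0 : P η)
    (hs : ∀ k ∈ A, ∀ μ ∈ orbit A η, P μ → P (act (simple k) μ)) {μ : Fin (n + 1) → ℕ}
    (h : μ ∈ orbit A η) : P μ := by
  obtain ⟨w, hw, rfl⟩ := mem_orbit.1 h
  refine W_induction (P := fun w => P (act w η)) ?_ (fun k hk w hw ih => ?_) hw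
  · rwa [act_one]
  · rw [act_mul]
    exact hs k hk _ (mem_orbit.2 ⟨w, hw, rfl⟩) ih

theorem eq_or_prec_of_mem_orbit {A : Finset (Fin n)} {η μ : Fin (n + 1) → ℕ}
    (hη : ∀ k ∈ A, η k.succ ≤ η k.castSucc) (h : μ ∈ orbit A η) : μ = η ∨ Prec μ η := by
  obtain ⟨w, hw, rfl⟩ := mem_orbit.1 h
  have hanti : ∀ {a b : Fin (n + 1)}, a ≤ b → blk A a = blk A b → η b ≤ η a := by
    intro a b hab hb
    rcases hab.eq_or_lt with rfl | hlt
    · exact le_rfl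
    · exact rel_of_blk_eq (R := fun a b => η b ≤ η a) (fun a b c h1 h2 => h2.trans h1) hη hlt hb
  by_cases he : act w η = η
  · exact Or.inl he
  refine Or.inr (Or.inr ⟨plus_act _ _, he, Equiv.sum_comp w⁻¹ η, fun p => ?_⟩)
  have h1 : ∑ j ∈ Finset.Iic p, act w η j = ∑ j ∈ (Finset.Iic p).map w⁻¹.toEmbedding, η j := by
    rw [Finset.sum_map]
    rfl
  rw [h1]
  -- Since `w` preserves blocks, the preimage of the initial segment differs from it only inside the
  -- block of `p`. There `η` is decreasing, so `η p` separates the positions gained from those lost.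
  refine sum_le_sum_of_separated (Finset.card_map _) (η p) ?_ ?_
  · intro x hx hxp
    obtain ⟨k, hk, rfl⟩ := Finset.mem_map.1 hx
    have hk := Finset.mem_Iic.1 hk
    have hxp : p < w⁻¹ k := not_le.1 fun h => hxp (Finset.mem_Iic.2 h)
    have hb : blk A (w⁻¹ k) = blk A k := blk_of_mem_W (inv_mem hw) k
    refine hanti hxp.le (le_antisymm (blk_mono A hxp.le) ?_)
    exact hb.le.trans (blk_mono A hk)
  · intro y hy hyp
    have hy := Finset.mem_Iic.1 hy
    have hwy : p < w y := by
      by_contra hc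
      refine hyp (Finset.mem_map.2 ⟨w y, Finset.mem_Iic.2 (not_lt.1 hc), ?_⟩)
      exact w.symm_apply_apply y
    refine hanti hy (le_antisymm (blk_mono A hy) ?_)
    rw [← blk_of_mem_W hw y]
    exact blk_mono A hwy.le

theorem IsLabel.anti {I J : Finset (Fin n)} {η : Fin (n + 1) → ℕ} (h : IsLabel I J η) :
    ∀ k ∈ I ∪ J, η k.succ ≤ η k.castSucc := fun k hk =>
  (Finset.mem_union.1 hk).elim (h.1 k) fun hk => (h.2 k hk).le

theorem Separated.symm {I J : Finset (Fin n)} (h : Separated I J) : Separated J I :=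
  ⟨h.1.symm, fun j hj i hi => (h.2 i hi j hj).symm⟩

theorem Separated.simple_apply {I J : Finset (Fin n)} (h : Separated I J) {i : Fin n}
    (hi : i ∈ I) {a b : Fin (n + 1)} (hab : a ≠ b) (hb : blk J a = blk J b) :
    simple i a = a :=
  simple_apply_of_blk_eq (Finset.disjoint_left.1 h.1 hi) (h.2 i hi) hab hb

/-- Compositions in the orbit of a label have distinct entries along the blocks of `J`. -/
theorem ne_of_mem_orbit {I J : Finset (Fin n)} (hIJ : Separated I J) {η μ : Fin (n + 1) → ℕ}
    (hη : IsLabel I J η) (h : μ ∈ orbit (I ∪ J) η) {j : Fin n} (hj : j ∈ J) :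
    μ j.castSucc ≠ μ j.succ := by
  have key : ∀ a b, a ≠ b → blk J a = blk J b → μ a ≠ μ b := by
    refine orbit_induction (P := fun μ => ∀ a b, a ≠ b → blk J a = blk J b → μ a ≠ μ b)
      ?_ ?_ h
    · have hlt : ∀ a b, a < b → blk J a = blk J b → η b < η a := fun a b hab hb =>
        rel_of_blk_eq (R := fun a b => η b < η a) (fun a b c h1 h2 => h2.trans h1) hη.2 hab hb
      intro a b hab hb
      rcases lt_or_gt_of_ne hab with h1 | h1
      · exact (hlt a b h1 hb).ne'
      · exact (hlt b a h1 hb.symm).ne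
    · intro k hk μ _ ih a b hab hb
      rw [act_simple, act_simple]
      rcases Finset.mem_union.1 hk with hk | hk
      · rw [hIJ.simple_apply hk hab hb, hIJ.simple_apply hk hab.symm hb.symm]
        exact ih a b hab hb
      · refine ih _ _ ((simple k).injective.ne hab) ?_
        rwa [blk_simple hk, blk_simple hk]
  exact key _ _ Fin.castSucc_lt_succ.ne (blk_castSucc_eq_succ_iff.2 hj)

end Blocks

/-! ### Expansion coefficients as inversion products, and their recursions. -/

section Coefficients

variable {n : ℕ} {K : Type*} [Field K]

/-- The product over the inversions of `κ` inside the blocks of `A`. -/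
noncomputable def invProd (α : K) (A : Finset (Fin n)) (ε : K) (κ : Fin (n + 1) → ℕ) : K :=
  ∏ q ∈ Finset.univ.filter (fun q : Fin (n + 1) × Fin (n + 1) =>
    q.1 < q.2 ∧ blk A q.1 = blk A q.2 ∧ κ q.1 < κ q.2), (ε + (eig α κ q.1 - eig α κ q.2)⁻¹)

theorem invProd_eq_one (α : K) {A : Finset (Fin n)} (ε : K) {κ : Fin (n + 1) → ℕ}
    (h : ∀ k ∈ A, κ k.succ ≤ κ k.castSucc) : invProd α A ε κ = 1 := by
  rw [invProd, Finset.filter_eq_empty_iff.2, Finset.prod_empty]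
  rintro ⟨a, b⟩ _ ⟨h1, h2, h3⟩
  exact h3.not_ge (rel_of_blk_eq (R := fun a b => κ b ≤ κ a) (fun a b c h1 h2 => h2.trans h1)
    h h1 h2)

theorem invProd_act_simple_of_mem (α : K) {A : Finset (Fin n)} (ε : K) {k : Fin n} (hk : k ∈ A)
    {μ : Fin (n + 1) → ℕ} (h : μ k.succ < μ k.castSucc) :
    invProd α A ε (act (simple k) μ) = (ε - (gap α k μ)⁻¹) * invProd α A ε μ := by
  have hmem : (k.castSucc, k.succ) ∈ Finset.univ.filter (fun q : Fin (n + 1) × Fin (n + 1) =>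
      q.1 < q.2 ∧ blk A q.1 = blk A q.2 ∧ act (simple k) μ q.1 < act (simple k) μ q.2) := by
    simp only [Finset.mem_filter, Finset.mem_univ, true_and, act_simple_castSucc,
      act_simple_succ]
    exact ⟨Fin.castSucc_lt_succ, blk_castSucc_eq_succ_iff.2 hk, h⟩
  rw [invProd, ← Finset.mul_prod_erase _ _ hmem]
  congr 1
  · have := gap_act_simple α h.ne'
    rw [gap] at this
    simp only
    rw [this, inv_neg, sub_eq_add_neg]
  · rw [invProd]
    -- Apart from the new inversion at `k`, `k + 1`, the inversions of `s_k μ` correspond under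
    -- `s_k` to those of `μ`, with the same eigenvalue differences.
    refine Finset.prod_bij (fun q _ => (simple k q.1, simple k q.2)) ?_ ?_ ?_ ?_
    · rintro ⟨a, b⟩ hq
      obtain ⟨hne, hq⟩ := Finset.mem_erase.1 hq
      simp only [Finset.mem_filter, Finset.mem_univ, true_and, act_simple] at hq ⊢
      refine ⟨(simple_lt_simple_iff ?_ ?_).2 hq.1, ?_, hq.2.2⟩
      · rintro ⟨rfl, rfl⟩
        exact hne rfl
      · rintro ⟨rfl, rfl⟩
        exact Fin.castSucc_lt_succ.not_gt hq.1
      · rw [blk_simple hk, blk_simple hk]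
        exact hq.2.1
    · rintro ⟨a, b⟩ _ ⟨c, d⟩ _ he
      rw [Prod.mk.injEq] at he
      exact Prod.ext ((simple k).injective he.1) ((simple k).injective he.2)
    · rintro ⟨a, b⟩ hq
      simp only [Finset.mem_filter, Finset.mem_univ, true_and] at hq
      refine ⟨(simple k a, simple k b), ?_, by simp only [simple_simple]⟩
      simp only [Finset.mem_erase, Finset.mem_filter, Finset.mem_univ, true_and, act_simple,
        simple_simple, blk_simple hk]
      refine ⟨fun he => ?_, (simple_lt_simple_iff ?_ ?_).2 hq.1, hq.2⟩
      · rw [Prod.mk.injEq] at he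
        have h1 := congrArg (simple k) he.1
        have h2 := congrArg (simple k) he.2
        rw [simple_simple, simple_castSucc] at h1
        rw [simple_simple, simple_succ] at h2
        rw [h1, h2] at hq
        exact Fin.castSucc_lt_succ.not_gt hq.1
      · rintro ⟨rfl, rfl⟩
        exact h.not_gt hq.2.2
      · rintro ⟨rfl, rfl⟩
        exact Fin.castSucc_lt_succ.not_gt hq.1
    · rintro ⟨a, b⟩ _
      simp only [eig_act_simple α h.ne']

theorem invProd_act_simple_of_apart (α : K) {A : Finset (Fin n)} (ε : K) {k : Fin n}
    (hk : ∀ a b, a ≠ b → blk A a = blk A b → simple k a = a) (μ : Fin (n + 1) → ℕ) :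
    invProd α A ε (act (simple k) μ) = invProd α A ε μ := by
  by_cases h : μ k.castSucc = μ k.succ
  · rw [act_simple_of_eq h]
  refine Finset.prod_congr (Finset.filter_congr ?_) ?_
  · rintro ⟨a, b⟩ _
    refine and_congr_right fun h1 => and_congr_right fun h2 => ?_
    simp only at h1 h2
    rw [act_simple, act_simple, hk a b h1.ne h2, hk b a h1.ne' h2.symm]
  · rintro ⟨a, b⟩ hq
    simp only [Finset.mem_filter, Finset.mem_univ, true_and] at hq
    simp only
    rw [eig_act_simple α h, eig_act_simple α h, hk a b hq.1.ne hq.2.1,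
      hk b a hq.1.ne' hq.2.1.symm]

/-- The coefficients of the expansion of the Jack polynomial with prescribed symmetry. -/
noncomputable def symCoeff (α : K) (I J : Finset (Fin n)) (κ : Fin (n + 1) → ℕ) : K :=
  invProd α I 1 κ * invProd α J (-1) κ

open Classical in
variable (K) in
/-- The sign by which `s_k` acts on polynomials with the prescribed symmetry. -/
noncomputable def sgn (J : Finset (Fin n)) (k : Fin n) : K := if k ∈ J then -1 else 1

theorem sgn_mul_self (J : Finset (Fin n)) (k : Fin n) : sgn K J k * sgn K J k = 1 := by
  rw [sgn]
  split_ifs <;> ring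

theorem symCoeff_label (α : K) {I J : Finset (Fin n)} {η : Fin (n + 1) → ℕ}
    (hη : IsLabel I J η) : symCoeff α I J η = 1 := by
  rw [symCoeff, invProd_eq_one α _ hη.1, invProd_eq_one α _ fun k hk => (hη.2 k hk).le, mul_one]

theorem symCoeff_act_simple (α : K) {I J : Finset (Fin n)} (hIJ : Separated I J) {k : Fin n}
    (hk : k ∈ I ∪ J) {μ : Fin (n + 1) → ℕ} (h : μ k.succ < μ k.castSucc) :
    symCoeff α I J (act (simple k) μ) = (sgn K J k - (gap α k μ)⁻¹) * symCoeff α I J μ := by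
  rw [symCoeff, symCoeff, sgn]
  rcases Finset.mem_union.1 hk with hk | hk
  · rw [if_neg (Finset.disjoint_left.1 hIJ.1 hk), invProd_act_simple_of_mem α 1 hk h,
      invProd_act_simple_of_apart α (-1) fun a b => hIJ.simple_apply hk, mul_assoc]
  · rw [if_pos hk, invProd_act_simple_of_mem α (-1) hk h,
      invProd_act_simple_of_apart α 1 fun a b => hIJ.symm.simple_apply hk, mul_left_comm]

/-- For `μ_k > μ_{k+1}`, the factor `1 - 1/δ` cancels the factor `δ/(δ - 1)` gained by `d'`. -/
theorem symCoeff_mul_dd' {α : K} (hα : ∀ a b : ℕ, 0 < a → (a : K) * α + (b : K) ≠ 0)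
    {I J : Finset (Fin n)} (hIJ : Separated I J) {k : Fin n} (hk : k ∈ I)
    (μ : Fin (n + 1) → ℕ) : symCoeff α I J (act (simple k) μ) * dd' α (act (simple k) μ)
      = symCoeff α I J μ * dd' α μ := by
  have key : ∀ μ : Fin (n + 1) → ℕ, μ k.succ < μ k.castSucc →
      symCoeff α I J (act (simple k) μ) * dd' α (act (simple k) μ)
        = symCoeff α I J μ * dd' α μ := by
    intro μ h
    have h1 := dd'_act_simple α h
    have h2 := (eig_sub_ne_of_gt hα h).1
    rw [symCoeff_act_simple α hIJ (Finset.mem_union_left _ hk) h, sgn,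
      if_neg (Finset.disjoint_left.1 hIJ.1 hk)]
    rw [← gap] at h1 h2
    field_simp
    linear_combination symCoeff α I J μ * h1
  rcases lt_trichotomy (μ k.castSucc) (μ k.succ) with h | h | h
  · have := key (act (simple k) μ) (by rwa [act_simple_castSucc, act_simple_succ])
    rw [act_simple_simple] at this
    exact this.symm
  · rw [act_simple_of_eq h]
  · exact key μ h

/-- For `μ_k > μ_{k+1}`, the factor `-1 - 1/δ` is minus the factor `(δ + 1)/δ` gained by `d`. -/
theorem symCoeff_mul_dd {α : K} (hα : ∀ a b : ℕ, 0 < a → (a : K) * α + (b : K) ≠ 0)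
    {I J : Finset (Fin n)} (hIJ : Separated I J) {k : Fin n} (hk : k ∈ J)
    {μ : Fin (n + 1) → ℕ} (hne : μ k.castSucc ≠ μ k.succ) :
    symCoeff α I J (act (simple k) μ) * dd α μ
      = - (symCoeff α I J μ * dd α (act (simple k) μ)) := by
  have key : ∀ μ : Fin (n + 1) → ℕ, μ k.succ < μ k.castSucc →
      symCoeff α I J (act (simple k) μ) * dd α μ
        = - (symCoeff α I J μ * dd α (act (simple k) μ)) := by
    intro μ h
    have h1 := dd_act_simple α h
    have h2 := (eig_sub_ne_of_gt hα h).1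
    rw [symCoeff_act_simple α hIJ (Finset.mem_union_right _ hk) h, sgn, if_pos hk]
    rw [← gap] at h1 h2
    field_simp
    linear_combination symCoeff α I J μ * h1
  rcases lt_or_gt_of_ne hne with h | h
  · have := key (act (simple k) μ) (by rwa [act_simple_castSucc, act_simple_succ])
    rw [act_simple_simple] at this
    rw [this, neg_neg]
  · exact key μ h

theorem offDiag_ne_zero {α : K} (hα : ∀ a b : ℕ, 0 < a → (a : K) * α + (b : K) ≠ 0) {k : Fin n}
    {μ : Fin (n + 1) → ℕ} (h : μ k.castSucc ≠ μ k.succ) : offDiag α k μ ≠ 0 := by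
  rw [offDiag]
  split_ifs with h1
  · exact one_ne_zero
  · obtain ⟨h2, h3⟩ := eig_sub_ne_of_ne hα h
    have h0 : gap α k μ ≠ 0 := eig_sub_ne_zero hα μ
    rw [← gap] at h2 h3
    intro h4
    field_simp at h4
    refine mul_ne_zero h2 h3 ?_
    linear_combination h4

/-- The left side is the coefficient of `E_μ` in `s_k` applied to the expansion. If `μ_k < μ_{k+1}`
the identity rests on `1 - δ⁻² = (ε - δ⁻¹)(ε + δ⁻¹)` with `ε = ±1`. If the entries agree, `δ = 1`
and the off-diagonal part is zero, which fits only the sign `+1`; hence equality is excluded for `k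
∈ J`. -/
theorem symCoeff_symmetric {α : K} {I J : Finset (Fin n)} (hIJ : Separated I J)
    {k : Fin n} (hk : k ∈ I ∪ J) {μ : Fin (n + 1) → ℕ}
    (hJ : k ∈ J → μ k.castSucc ≠ μ k.succ) :
    symCoeff α I J μ * (gap α k μ)⁻¹
        + symCoeff α I J (act (simple k) μ) * offDiag α k (act (simple k) μ)
      = sgn K J k * symCoeff α I J μ := by
  rcases lt_trichotomy (μ k.castSucc) (μ k.succ) with h | h | h
  · have h' : act (simple k) μ k.succ < act (simple k) μ k.castSucc := by
      rwa [act_simple_castSucc, act_simple_succ]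
    have h1 := symCoeff_act_simple α hIJ hk h'
    rw [act_simple_simple, gap_act_simple α h.ne, inv_neg] at h1
    rw [offDiag, if_neg h'.not_gt, gap_act_simple α h.ne, inv_neg, h1]
    linear_combination - symCoeff α I J (act (simple k) μ) * sgn_mul_self (K := K) J k
  · have hkJ : k ∉ J := fun hk => hJ hk h
    rw [act_simple_of_eq h, offDiag, if_neg h.not_lt, sgn, if_neg hkJ, gap, eig_sub_of_eq α h]
    simp
  · rw [symCoeff_act_simple α hIJ hk h, offDiag, if_pos (by
      rwa [act_simple_castSucc, act_simple_succ])]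
    ring

end Coefficients

/-! ### Symmetrization, the prescribed symmetry polynomial, and the closed formula. -/

section PrescribedSymmetry

variable {n : ℕ} {K : Type*} [Field K]

theorem rename_mul (v w : Equiv.Perm (Fin (n + 1))) (f : MvPolynomial (Fin (n + 1)) K) :
    rename (v * w) f = rename v (rename w f) := by
  rw [rename_rename]
  rfl

theorem rename_one (f : MvPolynomial (Fin (n + 1)) K) :
    rename (1 : Equiv.Perm (Fin (n + 1))) f = f := rename_id_apply f

/-- The combination of nonsymmetric Jack polynomials realizing the prescribed symmetry. -/
noncomputable def symJack (α : K) (I J : Finset (Fin n)) (η : Fin (n + 1) → ℕ) :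
    MvPolynomial (Fin (n + 1)) K :=
  ∑ μ ∈ orbit (I ∪ J) η, C (symCoeff α I J μ) * nonsymJack α μ

theorem coeff_sum_orbit [CharZero K] {α : K}
    (hα : ∀ a b : ℕ, 0 < a → (a : K) * α + (b : K) ≠ 0) {A : Finset (Fin n)}
    {η : Fin (n + 1) → ℕ} (hη : ∀ k ∈ A, η k.succ ≤ η k.castSucc)
    (g : (Fin (n + 1) → ℕ) → K) :
    coeff (Finsupp.equivFunOnFinite.symm η) (∑ μ ∈ orbit A η, C (g μ) * nonsymJack α μ)
      = g η := by
  rw [coeff_sum, Finset.sum_eq_single η, coeff_C_mul, coeff_nonsymJack_self hα, mul_one]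
  · intro μ hμ hne
    rw [coeff_C_mul, coeff_nonsymJack_eq_zero hα hne.symm, mul_zero]
    intro h
    exact Prec.irrefl _ (h.trans ((eq_or_prec_of_mem_orbit hη hμ).resolve_left hne))
  · exact fun h => absurd (self_mem_orbit _ _) h

theorem isMonicTriangular_symJack [CharZero K] {α : K}
    (hα : ∀ a b : ℕ, 0 < a → (a : K) * α + (b : K) ≠ 0) {I J : Finset (Fin n)}
    {η : Fin (n + 1) → ℕ} (hη : IsLabel I J η) : IsMonicTriangular η (symJack α I J η) := by
  refine ⟨?_, fun m hm hne => ?_⟩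
  · rw [symJack, coeff_sum_orbit hα hη.anti, symCoeff_label α hη]
  · rw [mem_support_iff, symJack, coeff_sum] at hm
    obtain ⟨μ, hμ, h⟩ := Finset.exists_ne_zero_of_sum_ne_zero hm
    rw [coeff_C_mul] at h
    have hmμ := (isNonsymJack_nonsymJack hα μ).2.2 m (mem_support_iff.2 (right_ne_zero_of_mul h))
    rcases eq_or_prec_of_mem_orbit hη.anti hμ with rfl | h1
    · exact hmμ hne
    · by_cases he : (m : Fin (n + 1) → ℕ) = μ
      · rwa [he]
      · exact (hmμ he).trans h1

theorem rename_simple_symJack [CharZero K] {α : K}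
    (hα : ∀ a b : ℕ, 0 < a → (a : K) * α + (b : K) ≠ 0) {I J : Finset (Fin n)}
    (hIJ : Separated I J) {η : Fin (n + 1) → ℕ} (hη : IsLabel I J η) {k : Fin n}
    (hk : k ∈ I ∪ J) :
    rename (simple k) (symJack α I J η) = C (sgn K J k) * symJack α I J η := by
  rw [symJack, rename_simple_sum hα k _ fun μ => act_simple_mem_orbit hk, Finset.mul_sum]
  refine Finset.sum_congr rfl fun μ hμ => ?_
  rw [symCoeff_symmetric hIJ hk fun hj => ne_of_mem_orbit hIJ hη hμ hj, C_mul, mul_assoc]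

theorem symJack_ne_zero [CharZero K] {α : K}
    (hα : ∀ a b : ℕ, 0 < a → (a : K) * α + (b : K) ≠ 0) {I J : Finset (Fin n)}
    {η : Fin (n + 1) → ℕ} (hη : IsLabel I J η) : symJack α I J η ≠ 0 := by
  intro h
  have := (isMonicTriangular_symJack hα hη).1
  rw [h, coeff_zero] at this
  exact zero_ne_one this

-- A polynomial with the prescribed symmetry sees a word only through its number of `J`-letters.
-- Applied to a nonzero one, this shows that the parity depends on the permutation alone, without
-- Coxeter theory.
open Classical in
theorem rename_word {J A : Finset (Fin n)} {F : MvPolynomial (Fin (n + 1)) K}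
    (hF : ∀ k ∈ A, rename (simple k) F = C (sgn K J k) * F) (l : List (Fin n))
    (hl : ∀ k ∈ l, k ∈ A) :
    rename ((l.map simple).prod) F
      = C ((-1 : K) ^ l.countP (fun k => decide (k ∈ J))) * F := by
  induction l with
  | nil => simp
  | cons k l ih =>
    rw [List.map_cons, List.prod_cons, rename_mul, ih fun j hj => hl j (List.mem_cons_of_mem _ hj),
      map_mul, rename_C, hF k (hl k List.mem_cons_self), List.countP_cons, sgn]
    by_cases hk : k ∈ J
    · simp only [hk, if_true, decide_true, pow_succ, C_mul]
      ring
    · simp [hk]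

theorem exists_word {A : Finset (Fin n)} {w : Equiv.Perm (Fin (n + 1))} (hw : w ∈ W A) :
    ∃ l : List (Fin n), (∀ k ∈ l, k ∈ A) ∧ (l.map simple).prod = w := by
  refine W_induction (P := fun w => ∃ l : List (Fin n), (∀ k ∈ l, k ∈ A)
    ∧ (l.map simple).prod = w) ⟨[], by simp⟩ ?_ hw
  rintro k hk w _ ⟨l, hl, rfl⟩
  exact ⟨k :: l, by simpa using ⟨hk, hl⟩, by simp⟩

/-- The sign `det_J` describes the action on polynomials with the prescribed symmetry. -/
theorem rename_eq_detJ {I J : Finset (Fin n)} {F : MvPolynomial (Fin (n + 1)) K}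
    (hF : ∀ k ∈ I ∪ J, rename (simple k) F = C (sgn K J k) * F)
    {w : Equiv.Perm (Fin (n + 1))} (hw : w ∈ W (I ∪ J)) :
    rename w F = C (detJ I J w : K) * F := by
  classical
  obtain ⟨l, hl, rfl⟩ := exists_word hw
  have hr := rename_word hF l hl
  rw [hr, detJ]
  split_ifs with h
  · obtain ⟨l', hl', he, hev⟩ := h
    have hr' := rename_word hF l' hl'
    rw [he, hr] at hr'
    have hev' : Even (l'.countP fun k => decide (k ∈ J)) := by convert hev
    rw [hr', hev'.neg_one_pow]
    simp
  · have hodd : ¬Even (l.countP fun k => decide (k ∈ J)) := fun hev =>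
      h ⟨l, hl, rfl, by convert hev⟩
    rw [(Nat.not_even_iff_odd.1 hodd).neg_one_pow]
    simp

theorem detJ_eq_one_or (I J : Finset (Fin n)) (w : Equiv.Perm (Fin (n + 1))) :
    detJ I J w = 1 ∨ detJ I J w = -1 := by
  rw [detJ]
  split_ifs
  · exact Or.inl rfl
  · exact Or.inr rfl

theorem detJ_mul_self (I J : Finset (Fin n)) (w : Equiv.Perm (Fin (n + 1))) :
    (detJ I J w : K) * (detJ I J w : K) = 1 := by
  rcases detJ_eq_one_or I J w with h | h <;> rw [h] <;> simp

theorem detJ_one (I J : Finset (Fin n)) : detJ I J 1 = 1 := by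
  rw [detJ, if_pos ⟨[], by simp⟩]

/-- Multiplicativity of the sign follows by comparing scalars acting on a nonzero polynomial `F`
with the prescribed symmetry. -/
theorem detJ_simple_mul {I J : Finset (Fin n)} {F : MvPolynomial (Fin (n + 1)) K}
    (hF0 : F ≠ 0) (hF : ∀ k ∈ I ∪ J, rename (simple k) F = C (sgn K J k) * F)
    {k : Fin n} (hk : k ∈ I ∪ J) {w : Equiv.Perm (Fin (n + 1))} (hw : w ∈ W (I ∪ J)) :
    (detJ I J (simple k * w) : K) = sgn K J k * (detJ I J w : K) := by
  have h := rename_eq_detJ hF (simple_mul_mem_W hk hw)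
  rw [rename_mul, rename_eq_detJ hF hw, map_mul, rename_C, hF k hk] at h
  have h' : C (sgn K J k * (detJ I J w : K)) * F = C (detJ I J (simple k * w) : K) * F := by
    rw [← h, C_mul]
    ring
  exact (C_injective _ _ (mul_right_cancel₀ hF0 h')).symm

theorem rename_simple_symOp {I J : Finset (Fin n)}
    {F : MvPolynomial (Fin (n + 1)) K} (hF0 : F ≠ 0)
    (hF : ∀ k ∈ I ∪ J, rename (simple k) F = C (sgn K J k) * F) {k : Fin n} (hk : k ∈ I ∪ J)
    (f : MvPolynomial (Fin (n + 1)) K) :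
    rename (simple k) (symOp I J f) = C (sgn K J k) * symOp I J f := by
  classical
  rw [symOp, map_sum, Finset.mul_sum]
  refine Finset.sum_bij (fun w _ => simple k * w) ?_ (fun a _ b _ h => mul_left_cancel h) ?_ ?_
  · intro w hw
    simp only [Finset.mem_filter, Finset.mem_univ, true_and] at hw ⊢
    exact simple_mul_mem_W hk hw
  · intro w hw
    simp only [Finset.mem_filter, Finset.mem_univ, true_and] at hw
    refine ⟨simple k * w, ?_, ?_⟩
    · simp only [Finset.mem_filter, Finset.mem_univ, true_and]
      exact simple_mul_mem_W hk hw
    · rw [← mul_assoc, simple, Equiv.swap_mul_self, one_mul]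
  · intro w hw
    simp only [Finset.mem_filter, Finset.mem_univ, true_and] at hw
    have hs : (C (sgn K J k) * C (sgn K J k) : MvPolynomial (Fin (n + 1)) K) = 1 := by
      rw [← C_mul, sgn_mul_self, C_1]
    rw [map_mul, rename_C, rename_mul, detJ_simple_mul hF0 hF hk hw, C_mul]
    linear_combination - C (detJ I J w : K) * rename (simple k) (rename w f) * hs

/-- The space spanned by the nonsymmetric Jack polynomials of an orbit. -/
noncomputable def orbitSpan (α : K) (A : Finset (Fin n)) (η : Fin (n + 1) → ℕ) :
    Submodule K (MvPolynomial (Fin (n + 1)) K) :=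
  Submodule.span K (nonsymJack α '' (orbit A η : Set (Fin (n + 1) → ℕ)))

theorem mem_orbitSpan {α : K} {A : Finset (Fin n)} {η : Fin (n + 1) → ℕ}
    {f : MvPolynomial (Fin (n + 1)) K} : f ∈ orbitSpan α A η ↔
      ∃ g : (Fin (n + 1) → ℕ) → K, f = ∑ μ ∈ orbit A η, C (g μ) * nonsymJack α μ := by
  constructor
  · intro h
    refine Submodule.span_induction (p := fun f _ => ∃ g : (Fin (n + 1) → ℕ) → K,
      f = ∑ μ ∈ orbit A η, C (g μ) * nonsymJack α μ) ?_ ?_ ?_ ?_ h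
    · classical
      rintro _ ⟨μ, hμ, rfl⟩
      refine ⟨fun ν => if ν = μ then 1 else 0, ?_⟩
      rw [Finset.sum_eq_single μ]
      · simp
      · intro ν _ hne
        simp [hne]
      · exact fun h => absurd hμ h
    · exact ⟨0, by simp⟩
    · rintro _ _ _ _ ⟨g, rfl⟩ ⟨g', rfl⟩
      refine ⟨fun μ => g μ + g' μ, ?_⟩
      simp only [C_add, add_mul, Finset.sum_add_distrib]
    · rintro a _ _ ⟨g, rfl⟩
      refine ⟨fun μ => a * g μ, ?_⟩
      simp only [smul_eq_C_mul, Finset.mul_sum, C_mul, mul_assoc]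
  · rintro ⟨g, rfl⟩
    refine Submodule.sum_mem _ fun μ hμ => ?_
    rw [← smul_eq_C_mul]
    exact Submodule.smul_mem _ _ (Submodule.subset_span ⟨μ, hμ, rfl⟩)

theorem rename_mem_orbitSpan [CharZero K] {α : K}
    (hα : ∀ a b : ℕ, 0 < a → (a : K) * α + (b : K) ≠ 0) {A : Finset (Fin n)}
    {η : Fin (n + 1) → ℕ} {w : Equiv.Perm (Fin (n + 1))} (hw : w ∈ W A)
    {f : MvPolynomial (Fin (n + 1)) K} (hf : f ∈ orbitSpan α A η) :
    rename w f ∈ orbitSpan α A η := by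
  refine W_induction (P := fun w => rename w f ∈ orbitSpan α A η) ?_ (fun k hk w _ ih => ?_) hw
  · rwa [rename_one]
  · rw [rename_mul]
    obtain ⟨g, hg⟩ := mem_orbitSpan.1 ih
    rw [hg, rename_simple_sum hα k _ fun μ => act_simple_mem_orbit hk]
    exact mem_orbitSpan.2 ⟨_, rfl⟩

theorem symOp_mem_orbitSpan [CharZero K] {α : K}
    (hα : ∀ a b : ℕ, 0 < a → (a : K) * α + (b : K) ≠ 0) {I J : Finset (Fin n)}
    {η : Fin (n + 1) → ℕ} {f : MvPolynomial (Fin (n + 1)) K}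
    (hf : f ∈ orbitSpan α (I ∪ J) η) : symOp I J f ∈ orbitSpan α (I ∪ J) η := by
  classical
  rw [symOp]
  refine Submodule.sum_mem _ fun w hw => ?_
  rw [← smul_eq_C_mul]
  refine Submodule.smul_mem _ _ (rename_mem_orbitSpan hα ?_ hf)
  simpa using hw

/-- An element of the span with the prescribed symmetry is determined by its leading
coefficient. -/
theorem eq_C_mul_symJack [CharZero K] {α : K}
    (hα : ∀ a b : ℕ, 0 < a → (a : K) * α + (b : K) ≠ 0) {I J : Finset (Fin n)}
    (hIJ : Separated I J) {η : Fin (n + 1) → ℕ} (hη : IsLabel I J η)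
    {f : MvPolynomial (Fin (n + 1)) K} (hf : f ∈ orbitSpan α (I ∪ J) η)
    (hs : ∀ k ∈ I ∪ J, rename (simple k) f = C (sgn K J k) * f) :
    f = C (coeff (Finsupp.equivFunOnFinite.symm η) f) * symJack α I J η := by
  set a := coeff (Finsupp.equivFunOnFinite.symm η) f
  rw [← sub_eq_zero]
  have hd : f - C a * symJack α I J η ∈ orbitSpan α (I ∪ J) η := by
    refine Submodule.sub_mem _ hf ?_
    rw [← smul_eq_C_mul]
    exact Submodule.smul_mem _ _ (mem_orbitSpan.2 ⟨_, rfl⟩)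
  have hc : coeff (Finsupp.equivFunOnFinite.symm η) (f - C a * symJack α I J η) = 0 := by
    rw [coeff_sub, coeff_C_mul, (isMonicTriangular_symJack hα hη).1, mul_one, sub_self]
  have hds : ∀ k ∈ I ∪ J, rename (simple k) (f - C a * symJack α I J η)
      = C (sgn K J k) * (f - C a * symJack α I J η) := fun k hk => by
    rw [map_sub, map_mul, rename_C, hs k hk, rename_simple_symJack hα hIJ hη hk]
    ring
  obtain ⟨g, hg⟩ := mem_orbitSpan.1 hd
  rw [hg] at hc hds ⊢
  rw [coeff_sum_orbit hα hη.anti] at hc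
  refine Finset.sum_eq_zero fun μ hμ => ?_
  suffices h : g μ = 0 by rw [h, C_0, zero_mul]
  -- The difference has zero coefficient at `η`. Comparing coefficients of `E_μ` in the symmetry
  -- under `s_k` passes the vanishing from `μ` to `s_k μ`, because the off-diagonal coefficient is
  -- nonzero.
  refine orbit_induction (P := fun μ => g μ = 0) hc (fun k hk μ hμ h0 => ?_) hμ
  by_cases he : μ k.castSucc = μ k.succ
  · rwa [act_simple_of_eq he]
  have h1 := hds k hk
  rw [rename_simple_sum hα k _ fun μ => act_simple_mem_orbit hk, Finset.mul_sum] at h1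
  simp only [← mul_assoc, ← C_mul] at h1
  have h2 := eq_of_sum_C_mul_nonsymJack_eq hα _ h1 μ hμ
  rw [h0, zero_mul, mul_zero, zero_add] at h2
  refine (mul_eq_zero.1 h2).resolve_right (offDiag_ne_zero hα ?_)
  rw [act_simple_castSucc, act_simple_succ]
  exact Ne.symm he

theorem isPrescribedJack_symJack [CharZero K] {α : K}
    (hα : ∀ a b : ℕ, 0 < a → (a : K) * α + (b : K) ≠ 0) {I J : Finset (Fin n)}
    (hIJ : Separated I J) {η : Fin (n + 1) → ℕ} (hη : IsLabel I J η) :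
    IsPrescribedJack α I J η (symJack α I J η) := by
  refine ⟨isMonicTriangular_symJack hα hη, fun μ hμ => ⟨coeff (Finsupp.equivFunOnFinite.symm η)
    (symOp I J (nonsymJack α μ)), ?_⟩⟩
  exact eq_C_mul_symJack hα hIJ hη
    (symOp_mem_orbitSpan hα (Submodule.subset_span ⟨μ, hμ, rfl⟩))
    fun k hk => rename_simple_symOp (symJack_ne_zero hα hη)
      (fun k hk => rename_simple_symJack hα hIJ hη hk) hk _

theorem symOp_sum (I J : Finset (Fin n)) {ι : Type*} (s : Finset ι) (c : ι → K)
    (f : ι → MvPolynomial (Fin (n + 1)) K) :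
    symOp I J (∑ i ∈ s, C (c i) * f i) = ∑ i ∈ s, C (c i) * symOp I J (f i) := by
  simp only [symOp, map_sum, map_mul, rename_C, Finset.mul_sum]
  rw [Finset.sum_comm]
  exact Finset.sum_congr rfl fun _ _ => Finset.sum_congr rfl fun _ _ => mul_left_comm _ _ _

/-- Each term of the symmetrizer acts by `det_J(w)² = 1`, so the scalar is the order of the group.
-/
theorem symOp_symJack [CharZero K] {α : K}
    (hα : ∀ a b : ℕ, 0 < a → (a : K) * α + (b : K) ≠ 0) {I J : Finset (Fin n)}
    (hIJ : Separated I J) {η : Fin (n + 1) → ℕ} (hη : IsLabel I J η) :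
    ∃ N : ℕ, N ≠ 0 ∧ symOp I J (symJack α I J η) = C (N : K) * symJack α I J η := by
  classical
  refine ⟨(Finset.univ.filter (fun w : Equiv.Perm (Fin (n + 1)) => w ∈ W (I ∪ J))).card,
    Finset.card_ne_zero_of_mem (a := 1) (by simp [one_mem]), ?_⟩
  have h : ∀ w ∈ Finset.univ.filter (fun w : Equiv.Perm (Fin (n + 1)) => w ∈ W (I ∪ J)),
      C (detJ I J w : K) * rename w (symJack α I J η) = symJack α I J η := by
    intro w hw
    rw [rename_eq_detJ
      (fun k hk => rename_simple_symJack hα hIJ hη hk) (by simpa using hw), ← mul_assoc, ← C_mul,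
      detJ_mul_self, C_1, one_mul]
  rw [symOp, map_natCast, ← nsmul_eq_mul, ← Finset.sum_const]
  convert Finset.sum_congr rfl h

/-- By linearity `O_{I,J}` sends `symJack` to a multiple of `S`, and also to a nonzero multiple of
`symJack`. Both polynomials are monic at `η`, so they agree. -/
theorem IsPrescribedJack.eq_symJack [CharZero K] {α : K}
    (hα : ∀ a b : ℕ, 0 < a → (a : K) * α + (b : K) ≠ 0) {I J : Finset (Fin n)}
    (hIJ : Separated I J) {η : Fin (n + 1) → ℕ} (hη : IsLabel I J η)
    {S : MvPolynomial (Fin (n + 1)) K} (hS : IsPrescribedJack α I J η S) :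
    S = symJack α I J η := by
  obtain ⟨N, hN, hNS⟩ := symOp_symJack hα hIJ hη
  have hmem : ∃ a : K, symOp I J (symJack α I J η) = C a * S := by
    choose! a ha using hS.2
    refine ⟨∑ μ ∈ orbit (I ∪ J) η, symCoeff α I J μ * a μ, ?_⟩
    rw [symJack, symOp_sum, map_sum, Finset.sum_mul]
    refine Finset.sum_congr rfl fun μ hμ => ?_
    rw [ha μ hμ, C_mul, mul_assoc]
  obtain ⟨a, ha⟩ := hmem
  rw [hNS] at ha
  have h1 := congrArg (coeff (Finsupp.equivFunOnFinite.symm η)) ha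
  rw [coeff_C_mul, coeff_C_mul, hS.1.1, (isMonicTriangular_symJack hα hη).1, mul_one,
    mul_one] at h1
  rw [← h1] at ha
  have hN' : (C (N : K) : MvPolynomial (Fin (n + 1)) K) ≠ 0 :=
    (map_ne_zero_iff _ (C_injective _ _)).2 (Nat.cast_ne_zero.2 hN)
  exact (mul_left_cancel₀ hN' ha).symm

theorem prescribedJack_eq_symJack [CharZero K] {α : K}
    (hα : ∀ a b : ℕ, 0 < a → (a : K) * α + (b : K) ≠ 0) {I J : Finset (Fin n)}
    (hIJ : Separated I J) {η : Fin (n + 1) → ℕ} (hη : IsLabel I J η) :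
    prescribedJack α I J η = symJack α I J η :=
  IsPrescribedJack.eq_symJack hα hIJ hη
    (Classical.epsilon_spec ⟨_, isPrescribedJack_symJack hα hIJ hη⟩)

theorem commute_of_separated {I J : Finset (Fin n)} (hIJ : Separated I J)
    {v w : Equiv.Perm (Fin (n + 1))} (hv : v ∈ W I) (hw : w ∈ W J) : Commute v w := by
  refine W_induction (P := fun v => Commute v w) (Commute.one_left w)
    (fun i hi v _ hvw => Commute.mul_left ?_ hvw) hv
  refine W_induction (P := fun w => Commute (simple i) w) (Commute.one_right _)
    (fun j hj w _ h => Commute.mul_right ?_ h) hw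
  have hb := blk_castSucc_eq_succ_iff.2 hj
  have h1 := hIJ.simple_apply hi Fin.castSucc_lt_succ.ne hb
  have h2 := hIJ.simple_apply hi Fin.castSucc_lt_succ.ne' hb.symm
  change simple i * Equiv.swap _ _ = Equiv.swap _ _ * simple i
  rw [Equiv.mul_swap_eq_swap_mul, h1, h2]

/-- The closed formula for the coefficients in terms of `d` and `d'`. -/
theorem symCoeff_act [CharZero K] {α : K}
    (hα : ∀ a b : ℕ, 0 < a → (a : K) * α + (b : K) ≠ 0) {I J : Finset (Fin n)}
    (hIJ : Separated I J) {η : Fin (n + 1) → ℕ} (hη : IsLabel I J η)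
    {v w : Equiv.Perm (Fin (n + 1))} (hv : v ∈ W I) (hw : w ∈ W J) :
    symCoeff α I J (act (v * w) η) = (detJ I J (v * w) : K) *
      (dd' α η * dd α (act (v * w) η)) / (dd' α (act v η) * dd α (act v η)) := by
  have hF0 := symJack_ne_zero hα hη
  have hF := fun k (hk : k ∈ I ∪ J) => rename_simple_symJack hα hIJ hη hk
  have hI := W_mono (Finset.subset_union_left (s₁ := I) (s₂ := J))
  have hJ := W_mono (Finset.subset_union_right (s₁ := I) (s₂ := J))
  -- Along `W_I` the sign is trivial and the product of coefficient and `d'` is constant, equal to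
  -- its value at `η`.
  have h1 : (detJ I J v : K) = 1 ∧ symCoeff α I J (act v η) * dd' α (act v η) = dd' α η := by
    refine W_induction (P := fun v => (detJ I J v : K) = 1 ∧
      symCoeff α I J (act v η) * dd' α (act v η) = dd' α η) ?_ (fun k hk v hv ih => ?_) hv
    · rw [detJ_one, act_one, symCoeff_label α hη]
      simp
    · rw [detJ_simple_mul hF0 hF (Finset.mem_union_left _ hk) (hI hv), ih.1, sgn,
        if_neg (Finset.disjoint_left.1 hIJ.1 hk), act_mul, symCoeff_mul_dd' hα hIJ hk]
      exact ⟨mul_one _, ih.2⟩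
  -- Along `W_J`, starting from `v η`, coefficient and signed `d` change by the same factor. The
  -- order `w * v`, allowed since the two subgroups commute, lets the induction multiply by
  -- generators on the left.
  have h2 : symCoeff α I J (act (w * v) η) * dd α (act v η)
      = (detJ I J (w * v) : K) * symCoeff α I J (act v η) * dd α (act (w * v) η) := by
    refine W_induction (P := fun w => symCoeff α I J (act (w * v) η) * dd α (act v η)
      = (detJ I J (w * v) : K) * symCoeff α I J (act v η) * dd α (act (w * v) η)) ?_
      (fun k hk w hw ih => ?_) hw
    · rw [one_mul, h1.1, one_mul]
    · have hwv : w * v ∈ W (I ∪ J) := mul_mem (hJ hw) (hI hv)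
      have hne := ne_of_mem_orbit hIJ hη (mem_orbit.2 ⟨_, hwv, rfl⟩) hk
      have h3 := symCoeff_mul_dd hα hIJ hk hne
      rw [mul_assoc, detJ_simple_mul hF0 hF (Finset.mem_union_right _ hk) hwv, act_mul, sgn,
        if_pos hk]
      refine mul_right_cancel₀ (dd_ne_zero hα (act (w * v) η)) ?_
      linear_combination dd α (act v η) * h3 - dd α (act (simple k) (act (w * v) η)) * ih
  rw [(commute_of_separated hIJ hv hw).eq]
  rw [eq_div_iff (mul_ne_zero (dd'_ne_zero hα _) (dd_ne_zero hα _))]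
  linear_combination dd' α (act v η) * h2
    + (detJ I J (w * v) : K) * dd α (act (w * v) η) * h1.2

end PrescribedSymmetry

end JackPS

theorem proposition1 {K : Type*} [Field K] [CharZero K] (α : K)
    (hα : ∀ a b : ℕ, 0 < a → (a : K) * α + (b : K) ≠ 0)
    (n : ℕ) (I J : Finset (Fin n)) (hIJ : JackPS.Separated I J)
    (ηs : Fin (n + 1) → ℕ) (hηs : JackPS.IsLabel I J ηs) :
    (∀ η : Fin (n + 1) → ℕ, ∃! E : MvPolynomial (Fin (n + 1)) K, JackPS.IsNonsymJack α η E) ∧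
    (∃! S : MvPolynomial (Fin (n + 1)) K, JackPS.IsPrescribedJack α I J ηs S) ∧
    (∃ c : (Fin (n + 1) → ℕ) → K,
      JackPS.prescribedJack α I J ηs =
        ∑ μ ∈ JackPS.orbit (I ∪ J) ηs, MvPolynomial.C (c μ) * JackPS.nonsymJack α μ) ∧
    (∀ c : (Fin (n + 1) → ℕ) → K,
      JackPS.prescribedJack α I J ηs =
        ∑ μ ∈ JackPS.orbit (I ∪ J) ηs, MvPolynomial.C (c μ) * JackPS.nonsymJack α μ →
      c ηs = 1 ∧
      ∀ w ∈ JackPS.W (I ∪ J), ∀ wI ∈ JackPS.W I, ∀ wJ ∈ JackPS.W J, w = wI * wJ →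
        c (JackPS.act w ηs) =
          (JackPS.detJ I J w : K) *
            (JackPS.dd' α ηs * JackPS.dd α (JackPS.act w ηs)) /
              (JackPS.dd' α (JackPS.act wI ηs) * JackPS.dd α (JackPS.act wI ηs))) := by
  have hS := JackPS.prescribedJack_eq_symJack hα hIJ hηs
  refine ⟨JackPS.existsUnique_isNonsymJack hα,
    ⟨_, JackPS.isPrescribedJack_symJack hα hIJ hηs, fun S h => h.eq_symJack hα hIJ hηs⟩,
    ⟨_, hS⟩, fun c hc => ?_⟩
  -- Linear independence of the `E_μ` identifies an arbitrary expansion with the constructed one.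
  have hcoeff := JackPS.eq_of_sum_C_mul_nonsymJack_eq hα _ (hc.symm.trans hS)
  refine ⟨?_, ?_⟩
  · rw [hcoeff _ (JackPS.self_mem_orbit _ _), JackPS.symCoeff_label α hηs]
  · rintro w hw wI hwI wJ hwJ rfl
    rw [hcoeff _ (JackPS.mem_orbit.2 ⟨_, hw, rfl⟩), JackPS.symCoeff_act hα hIJ hηs hwI hwJ]
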